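/- **Theorem (generalized Pappus centroid theorem).** Let $N\ge 1$ and let $\mathbb X^N$ be $\mathbb E^N$, $\mathbb S^N$ or $\mathbb H^N$, realized in $\mathbb R^{N+1}$ with the form $\langle a,b\rangle=\sum_{i\le N}a_ib_i+\delta\, a_{N+1}b_{N+1}$ ($\delta=-1$ for $\mathbb H^N$, $\delta=1$ otherwise) as $\{x_{N+1}=1\}$, $\{\langle x,x\rangle=1\}$, $\{\langle x,x\rangle=-1,\ x_{N+1}>0\}$ respectively, with the Riemannian volume: $dV=\sqrt{|\det((Dr)^{T}J\,Dr)|}\,ds$ in a parametrization $r(s)$, where $J=\operatorname{diag}(1,\dots,1,\delta)$. For a set $L$ in a hyperplane of $\mathbb X^N$ (a totally geodesic hypersurface, with $(N-1)$-dimensional volume $dV$) and a mass distribution $\rho\ge 0$ of finite mass on $L$, the mass center vector is $\mathcal F(L)=\int_L\rho(r)\,r\,dV\in\mathbb R^{N+1}$. If $\mathcal F(L)=m\,c$ with $m\ge 0$ and $c\in\mathbb X^N$, then $c$ is called a mass center of $L$ (the zero vector represents every point, with mass $0$), and the centered mass is $m_{\rm cen}(L,\rho)=m$, that is, the last coordinate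 of $\mathcal F(L)$ for $\mathbb E^N$, and $\sqrt{\delta\langle \mathcal F(L),\mathcal F(L)\rangle}$ for $\mathbb S^N$, $\mathbb H^N$. Let $\mathcal P\subset\mathbb X^N$ be a Pappus solid with measurable mass distribution $\rho\ge0$. That is, $\mathcal P$ is bounded and is the disjoint union of sections $L_t$, $t\in I$, where $I\subset\mathbb R$ is an interval and $\{(t,r):t\in I,\ r\in L_t\}$ is measurable, such that: * there is an injective $C^1$ curve $\mathbf c:I\to\mathbb X^N$ parametrized by arclength, $\langle \mathbf c',\mathbf c'\rangle=1$ (the centroid curve), and for each $t\in I$ a unit tangent vector $\mathbf p(t)\in T_{\mathbf c(t)}\mathbb X^N$, depending on $t$ in a $C^1$ way, such that $L_t$ is contained in the hyperplane $H_t=\{r\in\mathbb X^N:\langle r-\mathbf c(t),\mathbf p(t)\rangle=0\}$ through $\mathbf c(t)$ with normal $\mathbf p(t)$; * $L_t$ has finite mass and $\mathbf c(t)$ is a mass center of $(L_t,\rho)$, for each $t\in I$; * the lamination is regular over a connected parameter domain: there is a connected set $\Omega\subset\{(t,r):t\in I,\ r\in H_t\}$ which contains $\{(t,r):t\in I,\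 r\in L_t\}$ and at each point $(t,r)$ of which $\frac{d}{dt}\langle r-\mathbf c(t),\mathbf p(t)\rangle\neq0$ ($r$ being held fixed; one-sided derivatives at endpoints of $I$). Let $\theta_t\in[0,\pi/2]$, $\cos\theta_t=|\langle \mathbf c'(t),\mathbf p(t)\rangle|$, be the slant angle of $H_t$ with respect to the curve. Then $t\mapsto m_{\rm cen}(L_t,\rho)\cos\theta_t$ is Lebesgue measurable on $I$ and $$m_{\rm tot}(\mathcal P,\rho):=\int_{\mathcal P}\rho\,dV=\int_I m_{\rm cen}(L_t,\rho)\cos\theta_t\,dt$$ as an equality in $[0,\infty]$. -/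

import Mathlib

open MeasureTheory

namespace Pappus

/-- The three geometries: Euclidean, spherical and hyperbolic. -/
inductive Geometry
  | euclidean
  | spherical
  | hyperbolic

/-- The ambient vector space `ℝ^(k+1)` of the `k`-dimensional space `X^k`. -/
abbrev Ambient (k : ℕ) : Type := EuclideanSpace ℝ (Fin (k + 1))

/-- The sign `δ_X`: `1` for `E^k` and `S^k`, and `-1` for `H^k`. -/
def Geometry.delta : Geometry → ℝ
  | .euclidean => 1
  | .spherical => 1
  | .hyperbolic => -1

/-- The bilinear form `⟨a, b⟩ = a₁ b₁ + ⋯ + a_k b_k + δ_X a_{k+1} b_{k+1}` on `ℝ^(k+1)`. -/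
def form (X : Geometry) {k : ℕ} (a b : Ambient k) : ℝ :=
  (∑ i : Fin k, a i.castSucc * b i.castSucc) + X.delta * (a (Fin.last k) * b (Fin.last k))

/-- The space `X^k`, as a subset of `ℝ^(k+1)`: the affine hyperplane `x_{k+1} = 1`, the unit
sphere, or the upper sheet of the hyperboloid. -/
def space (X : Geometry) (k : ℕ) : Set (Ambient k) :=
  match X with
  | .euclidean => {r | r (Fin.last k) = 1}
  | .spherical => {r | form .spherical r r = 1}
  | .hyperbolic => {r | form .hyperbolic r r = -1 ∧ 0 < r (Fin.last k)}

/-- The tangent vectors to `X^k` at the point `c`, as vectors of `ℝ^(k+1)`. -/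
def tangent (X : Geometry) {k : ℕ} (c : Ambient k) : Set (Ambient k) :=
  match X with
  | .euclidean => {v | v (Fin.last k) = 0}
  | .spherical => {v | form .spherical v c = 0}
  | .hyperbolic => {v | form .hyperbolic v c = 0}

/-- The hyperplane of `X^k` through the point `c` with normal vector `ν` (tangent to `X^k`
at `c`). For `S^k` and `H^k` one has `⟨c, ν⟩ = 0`, so that it is `{r ∈ X^k | ⟨r, ν⟩ = 0}`
and `ν` is its polar vector. -/
def hyperplane (X : Geometry) {k : ℕ} (c ν : Ambient k) : Set (Ambient k) :=
  {r | r ∈ space X k ∧ form X (r - c) ν = 0}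

/-- The slant angle in `[0, π/2]` of the hyperplane with normal vector `ν` with respect to the
tangent vector `τ`: the angle between the line of `ν` and `τ`. -/
noncomputable def slantAngle (X : Geometry) {k : ℕ} (τ ν : Ambient k) : ℝ :=
  Real.arccos (|form X τ ν| / Real.sqrt (form X τ τ * form X ν ν))

/-! ### Volume -/

/-- The Gram matrix `(Dr)ᵀ J (Dr)` of a parametrization `r` of a `j`-dimensional piece
of `X^k`. -/
noncomputable def gram (X : Geometry) {j k : ℕ} (r : EuclideanSpace ℝ (Fin j) → Ambient k)
    (s : EuclideanSpace ℝ (Fin j)) : Matrix (Fin j) (Fin j) ℝ :=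
  Matrix.of fun a b =>
    form X (fderiv ℝ r s (EuclideanSpace.single a 1)) (fderiv ℝ r s (EuclideanSpace.single b 1))

/-- The `j`-dimensional volume `dV_j = √|det((Dr)ᵀ J (Dr))| ds₁ ⋯ ds_j` of the piece parametrized
by `r` over the domain `U ⊆ ℝ^j`, as a measure on the ambient space. -/
noncomputable def patchVolume (X : Geometry) {j k : ℕ}
    (r : EuclideanSpace ℝ (Fin j) → Ambient k) (U : Set (EuclideanSpace ℝ (Fin j))) :
    Measure (Ambient k) :=
  (((volume : Measure (EuclideanSpace ℝ (Fin j))).restrict U).withDensity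
    fun s => ENNReal.ofReal (Real.sqrt |(gram X r s).det|)).map r

/-- The domain of the graph parametrization of `X^k`: all of `ℝ^k`, or the open unit ball in the
spherical case. -/
def chartDomain (X : Geometry) (k : ℕ) : Set (EuclideanSpace ℝ (Fin k)) :=
  match X with
  | .euclidean => Set.univ
  | .spherical => {x | ‖x‖ < 1}
  | .hyperbolic => Set.univ

/-- The height of the graph over `ℝ^k`. -/
noncomputable def height (X : Geometry) {k : ℕ} (x : EuclideanSpace ℝ (Fin k)) : ℝ :=
  match X with
  | .euclidean => 1
  | .spherical => Real.sqrt (1 - ‖x‖ ^ 2)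
  | .hyperbolic => Real.sqrt (1 + ‖x‖ ^ 2)

/-- The graphs needed to cover `X^k` (up to the equator in the spherical case): one for `E^k` and
`H^k`, and two, the open upper and lower hemispheres, for `S^k`. -/
noncomputable def sheets : Geometry → Finset ℝ
  | .euclidean => {1}
  | .spherical => {1, -1}
  | .hyperbolic => {1}

/-- The graph parametrization `x ↦ (x, σ h(x))` of `X^k`. -/
noncomputable def graphParam (X : Geometry) (k : ℕ) (σ : ℝ) (x : EuclideanSpace ℝ (Fin k)) :
    Ambient k :=
  WithLp.toLp 2 (Fin.snoc (α := fun _ => ℝ) (fun i => x i) (σ * height X x))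

/-- The Riemannian volume measure `dV_k` of `X^k`, as a measure on `ℝ^(k+1)`. -/
noncomputable def spaceVolume (X : Geometry) (k : ℕ) : Measure (Ambient k) :=
  ∑ σ ∈ sheets X, patchVolume X (graphParam X k σ) (chartDomain X k)

/-- `e₁, …, e_k` is an orthonormal basis of the tangent space at `c` of the hyperplane
of `X^(k+1)` through `c` with normal vector `ν`. -/
def IsHyperplaneFrame (X : Geometry) {k : ℕ} (c ν : Ambient (k + 1))
    (e : Fin k → Ambient (k + 1)) : Prop :=
  (∀ i, e i ∈ tangent X c) ∧ (∀ i j, form X (e i) (e j) = if i = j then 1 else 0) ∧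
    ∀ i, form X (e i) ν = 0

/-- The map `y ↦ y₁ e₁ + ⋯ + y_k e_k + y_{k+1} c`, which sends `X^k` onto the hyperplane
of `X^(k+1)` through `c` with tangent frame `e`. -/
def frameMap {k : ℕ} (c : Ambient (k + 1)) (e : Fin k → Ambient (k + 1)) (y : Ambient k) :
    Ambient (k + 1) :=
  (∑ i : Fin k, y i.castSucc • e i) + y (Fin.last k) • c

open Classical in
/-- The `k`-dimensional Riemannian volume measure on the hyperplane of `X^(k+1)` through `c` with
normal vector `ν`, computed in the parametrization `F ∘ Φ`, where `Φ` parametrizes `X^k` and `F` is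
the map attached to an orthonormal frame (the result does not depend on the frame). -/
noncomputable def hyperplaneVolume (X : Geometry) {k : ℕ} (c ν : Ambient (k + 1)) :
    Measure (Ambient (k + 1)) :=
  if h : ∃ e : Fin k → Ambient (k + 1), IsHyperplaneFrame X c ν e then
    ∑ σ ∈ sheets X, patchVolume X (frameMap c h.choose ∘ graphParam X k σ) (chartDomain X k)
  else 0

/-! ### Mass, mass center, centered mass -/

/-- The total mass `∫_P ρ dV` of a `k`-dimensional body `P` in `X^k` with the nonnegative mass
distribution `ρ`. -/
noncomputable def totalMass (X : Geometry) {k : ℕ} (P : Set (Ambient k)) (ρ : Ambient k → ℝ) :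
    ENNReal :=
  ∫⁻ r in P, ENNReal.ofReal (ρ r) ∂(spaceVolume X k)

/-- The mass `m` of a material vector `v = m r`, where `m ≥ 0` and `r ∈ X^k`. -/
noncomputable def materialMass (X : Geometry) {k : ℕ} (v : Ambient k) : ℝ :=
  match X with
  | .euclidean => v (Fin.last k)
  | .spherical => Real.sqrt (form .spherical v v)
  | .hyperbolic => Real.sqrt (-form .hyperbolic v v)

theorem form_smul_smul (X : Geometry) {k : ℕ} (m : ℝ) (r : Ambient k) :
    form X (m • r) (m • r) = m ^ 2 * form X r r := by
  simp only [form, PiLp.smul_apply, smul_eq_mul, mul_add, Finset.mul_sum]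
  congr 1
  · exact Finset.sum_congr rfl fun i _ => by ring
  · ring

theorem materialMass_smul (X : Geometry) {k : ℕ} {m : ℝ} (hm : 0 ≤ m) {r : Ambient k}
    (hr : r ∈ space X k) : materialMass X (m • r) = m := by
  cases X with
  | euclidean =>
    have h : r (Fin.last k) = 1 := hr
    simp [materialMass, h]
  | spherical =>
    have h : form .spherical r r = 1 := hr
    simp [materialMass, form_smul_smul, h, Real.sqrt_sq hm]
  | hyperbolic =>
    have h : form .hyperbolic r r = -1 := hr.1
    simp [materialMass, form_smul_smul, h, Real.sqrt_sq hm]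

/-- The mass center vector `∫_L ρ r dV` of a section `L` contained in the hyperplane through `c`
with normal vector `ν`. -/
noncomputable def massCenterVector (X : Geometry) {k : ℕ} (c ν : Ambient (k + 1))
    (L : Set (Ambient (k + 1))) (ρ : Ambient (k + 1) → ℝ) : Ambient (k + 1) :=
  ∫ r in L, ρ r • r ∂(hyperplaneVolume X c ν)

/-- The centered mass `m_cen(L, ρ)` of such a section: the mass of its mass center vector. -/
noncomputable def centeredMass (X : Geometry) {k : ℕ} (c ν : Ambient (k + 1))
    (L : Set (Ambient (k + 1))) (ρ : Ambient (k + 1) → ℝ) : ℝ :=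
  materialMass X (massCenterVector X c ν L ρ)

/-! ### Pappus solids -/

/-- The pairs `(t, r)` with `t ∈ I` and `r` in the section `L t`. -/
def parameterSet {k : ℕ} (I : Set ℝ) (L : ℝ → Set (Ambient k)) : Set (ℝ × Ambient k) :=
  {q | q.1 ∈ I ∧ q.2 ∈ L q.1}

/-- `P ⊆ X^(n+1)` with the mass distribution `ρ` is a Pappus solid: it is laminated by the
hyperplanar sections `L t`, `t ∈ I`, the section `L t` lying in the hyperplane through `c t` with
unit normal vector `ν t` and having its mass center at `c t`.

Neither the solid nor its sections are required to be manifolds: measurability is enough. -/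
structure IsPappusSolid (X : Geometry) {n : ℕ} (P : Set (Ambient (n + 1)))
    (ρ : Ambient (n + 1) → ℝ) (I : Set ℝ) (c ν : ℝ → Ambient (n + 1))
    (L : ℝ → Set (Ambient (n + 1))) : Prop where
  /-- The parameter `t` ranges over an interval. -/
  interval : I.OrdConnected
  /-- The centroid curve lies in the space (not necessarily in the solid), is `C¹`, simple and
  parametrized by its arclength. -/
  curve_mem : ∀ t ∈ I, c t ∈ space X (n + 1)
  curve_contDiffOn : ContDiffOn ℝ 1 c I
  curve_injOn : Set.InjOn c I
  curve_unitSpeed : ∀ t ∈ I, form X (derivWithin c I t) (derivWithin c I t) = 1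
  /-- The hyperplanes, given by their unit normal vectors, move in a `C¹` way. -/
  normal_tangent : ∀ t ∈ I, ν t ∈ tangent X (c t)
  normal_unit : ∀ t ∈ I, form X (ν t) (ν t) = 1
  normal_contDiffOn : ContDiffOn ℝ 1 ν I
  /-- The sections lie in the hyperplanes, are disjoint, and fill the solid, which is bounded. -/
  section_subset : ∀ t ∈ I, L t ⊆ hyperplane X (c t) (ν t)
  section_disjoint : I.PairwiseDisjoint L
  solid_eq : P = ⋃ t ∈ I, L t
  solid_bounded : Bornology.IsBounded P
  measurableSet_parameterSet : MeasurableSet (parameterSet I L)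
  /-- The lamination is regular over a connected set of parameters `(t, r)`, `r` in the hyperplane
  at time `t`, which contains those of the solid (for example over the parameters of the solid, if
  these form a connected set): the moving hyperplane `{r | ⟨r - c t, ν t⟩ = 0}` passes through each
  point with nonzero normal velocity; equivalently, a `C¹` parametrization of the points of the
  hyperplanes by `t` and by coordinates in the hyperplane has an invertible differential. -/
  regular : ∃ Ω : Set (ℝ × Ambient (n + 1)), IsPreconnected Ω ∧ parameterSet I L ⊆ Ω ∧
    ∀ q ∈ Ω, q.1 ∈ I ∧ q.2 ∈ hyperplane X (c q.1) (ν q.1) ∧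
      derivWithin (fun s => form X (q.2 - c s) (ν s)) I q.1 ≠ 0
  /-- The mass distribution is nonnegative, and each section has a finite mass. -/
  density_measurable : Measurable ρ
  density_nonneg : ∀ r ∈ P, 0 ≤ ρ r
  section_finite : ∀ t ∈ I, IntegrableOn ρ (L t) (hyperplaneVolume X (c t) (ν t))
  /-- The mass center of the section `L t` is `c t`. -/
  massCenter : ∀ t ∈ I,
    massCenterVector X (c t) (ν t) (L t) ρ = centeredMass X (c t) (ν t) (L t) ρ • c t

end Pappus

namespace Pappus

open Set

/-! ### Moving linear hyperplanes -/

/-! The three geometries are treated at once by passing to the cone over the solid in `ℝ^(n+2)`. The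
hyperplane at time `t` spans a linear hyperplane `a(t) ⬝ᵥ x = 0`, with `a(t)` given by
`normalCovector`, and the cones over the sections sweep out the cone over the solid.

For a moving linear hyperplane, Lebesgue measure is `dt` times the measure `leray (a t)` on the
hyperplane times `|a'(t) ⬝ᵥ x|` (`lintegral_lamination`). In homogeneous coordinates `x = s r`,
Lebesgue measure on the ambient space is `s^(n+1) ds dV` (`lintegral_radial`), and the hyperplane
measure is `s^n ds dV`, with `dV` the volume of the section (`leray_radial`). Since `|a' ⬝ᵥ (s r)| =
s |a' ⬝ᵥ r|`, truncating the cone at `s ≤ 1` yields the same constant `K` on both sides. Cancelling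
it leaves the mass as the integral over `t` of `∫ ρ |a'(t) ⬝ᵥ r| dV` over `L t`
(`totalMass_eq_lintegral_leray`).

On points `r` of the space, `a'(t) ⬝ᵥ r` is the normal velocity of the moving hyperplane. Regularity
over a connected set gives it a constant sign on the solid (`velocity_sign`), so the absolute value
comes out of the integral. By linearity in `r` only the mass center vector `m c(t)` matters, and at
`c(t)` the velocity is `-⟨c', ν⟩`, of absolute value `cos θ_t` (`lintegral_section`). -/

theorem lintegral_pi_insertNth {m : ℕ} (i : Fin (m + 1)) {f : (Fin (m + 1) → ℝ) → ENNReal}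
    (hf : Measurable f) :
    ∫⁻ x, f x = ∫⁻ w : Fin m → ℝ, ∫⁻ q : ℝ, f (i.insertNth q w) := by
  have h := (volume_preserving_piFinSuccAbove (fun _ : Fin (m + 1) => ℝ) i).symm
  rw [← h.lintegral_comp hf, Measure.volume_eq_prod, lintegral_prod_symm]
  · rfl
  · exact (hf.comp (MeasurableEquiv.measurable _)).aemeasurable

/-- The coordinate `i` of the point of the hyperplane `{x | ∑ aⱼ xⱼ = 0}` whose other coordinates
are given by `w`. -/
noncomputable def solveCoord {m : ℕ} (i : Fin (m + 1)) (a : Fin (m + 1) → ℝ) (w : Fin m → ℝ) : ℝ :=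
  -(∑ j, a (i.succAbove j) * w j) / a i

/-- The point of the hyperplane `{x | ∑ aⱼ xⱼ = 0}` whose coordinates other than the one of
index `i` are given by `w`. -/
noncomputable def solvePoint {m : ℕ} (i : Fin (m + 1)) (a : Fin (m + 1) → ℝ) (w : Fin m → ℝ) :
    Fin (m + 1) → ℝ :=
  i.insertNth (α := fun _ => ℝ) (solveCoord i a w) w

theorem dotProduct_insertNth {m : ℕ} (i : Fin (m + 1)) (a : Fin (m + 1) → ℝ) (q : ℝ)
    (w : Fin m → ℝ) :
    a ⬝ᵥ (i.insertNth (α := fun _ => ℝ) q w) = a i * q + ∑ j, a (i.succAbove j) * w j := by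
  simp [dotProduct, Fin.sum_univ_succAbove _ i]

theorem measurable_insertNth {m : ℕ} (i : Fin (m + 1)) :
    Measurable fun p : ℝ × (Fin m → ℝ) => i.insertNth (α := fun _ => ℝ) p.1 p.2 :=
  (MeasurableEquiv.piFinSuccAbove (fun _ : Fin (m + 1) => ℝ) i).symm.measurable

theorem measurable_solveCoord {m : ℕ} (i : Fin (m + 1)) {Z : Type*} [MeasurableSpace Z]
    {a : Z → Fin (m + 1) → ℝ} {w : Z → Fin m → ℝ} (ha : Measurable a) (hw : Measurable w) :
    Measurable fun z => solveCoord i (a z) (w z) := by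
  unfold solveCoord
  fun_prop

theorem measurable_solvePoint {m : ℕ} (i : Fin (m + 1)) {Z : Type*} [MeasurableSpace Z]
    {a : Z → Fin (m + 1) → ℝ} {w : Z → Fin m → ℝ} (ha : Measurable a) (hw : Measurable w) :
    Measurable fun z => solvePoint i (a z) (w z) :=
  (measurable_insertNth i).comp ((measurable_solveCoord i ha hw).prodMk hw)

/-- `i` is the first index at which `a` does not vanish. -/
def IsFirst {m : ℕ} (a : Fin (m + 1) → ℝ) (i : Fin (m + 1)) : Prop :=
  a i ≠ 0 ∧ ∀ j < i, a j = 0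

/-- Selecting the first nonzero coefficient splits the times into finitely many disjoint measurable
pieces, on each of which the same coordinate can be solved for. -/
theorem IsFirst.unique {m : ℕ} {a : Fin (m + 1) → ℝ} {i j : Fin (m + 1)} (hi : IsFirst a i)
    (hj : IsFirst a j) : i = j := by
  rcases lt_trichotomy i j with h | h | h
  · exact absurd (hj.2 i h) hi.1
  · exact h
  · exact absurd (hi.2 j h) hj.1

theorem exists_isFirst {m : ℕ} {a : Fin (m + 1) → ℝ} (ha : a ≠ 0) : ∃ i, IsFirst a i := by
  obtain ⟨i, hi⟩ := Function.ne_iff.1 ha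
  obtain ⟨j, hj, hmin⟩ := wellFounded_lt.has_min {i | a i ≠ 0} ⟨i, hi⟩
  exact ⟨j, hj, fun k hk => by_contra fun h => hmin k h hk⟩

theorem measurableSet_isFirst {m : ℕ} (i : Fin (m + 1)) : MeasurableSet {a | IsFirst a i} := by
  have h : {a : Fin (m + 1) → ℝ | IsFirst a i}
      = {a | a i = 0}ᶜ ∩ ⋂ j : Fin (m + 1), ⋂ _ : j < i, {a | a j = 0} := by
    ext a
    simp [IsFirst]
  rw [h]
  exact ((measurableSet_eq_fun (measurable_pi_apply i) measurable_const).compl).inter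
    (MeasurableSet.iInter fun j => MeasurableSet.iInter fun _ =>
      measurableSet_eq_fun (measurable_pi_apply j) measurable_const)

open Classical in
/-- The integral over the hyperplane `{x | ∑ aⱼ xⱼ = 0}` with respect to the measure whose product
with Lebesgue measure, for the coordinate `∑ aⱼ xⱼ`, is the Lebesgue measure of the space. -/
noncomputable def leray {m : ℕ} (a : Fin (m + 1) → ℝ) (g : (Fin (m + 1) → ℝ) → ENNReal) :
    ENNReal :=
  ∑ i, if IsFirst a i then ENNReal.ofReal |a i|⁻¹ * ∫⁻ w, g (solvePoint i a w) else 0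

theorem leray_eq {m : ℕ} {a : Fin (m + 1) → ℝ} {i : Fin (m + 1)} (hi : IsFirst a i)
    (g : (Fin (m + 1) → ℝ) → ENNReal) :
    leray a g = ENNReal.ofReal |a i|⁻¹ * ∫⁻ w, g (solvePoint i a w) := by
  unfold leray
  rw [Finset.sum_eq_single i, if_pos hi]
  · exact fun j _ hj => if_neg fun h => hj (h.unique hi)
  · exact fun h => absurd (Finset.mem_univ i) h

theorem measurable_leray {m : ℕ} {Z : Type*} [MeasurableSpace Z] {a : Z → Fin (m + 1) → ℝ}
    (ha : Measurable a) {g : Z × (Fin (m + 1) → ℝ) → ENNReal} (hg : Measurable g) :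
    Measurable fun z => leray (a z) fun x => g (z, x) := by
  unfold leray
  refine Finset.measurable_fun_sum _ fun i _ => Measurable.ite (ha (measurableSet_isFirst i)) ?_
    measurable_const
  refine Measurable.mul (by fun_prop) ?_
  refine Measurable.lintegral_prod_right' (f := fun p : Z × (Fin m → ℝ) =>
    g (p.1, solvePoint i (a p.1) p.2)) ?_
  exact hg.comp (measurable_fst.prodMk
    (measurable_solvePoint i (ha.comp measurable_fst) measurable_snd))

theorem solveCoord_eq {m : ℕ} {i : Fin (m + 1)} {a : Fin (m + 1) → ℝ} (hi : a i ≠ 0) {y : ℝ}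
    {w : Fin m → ℝ} (h : a ⬝ᵥ (i.insertNth (α := fun _ => ℝ) y w) = 0) :
    solveCoord i a w = y := by
  rw [dotProduct_insertNth] at h
  unfold solveCoord
  field_simp
  linarith

/-- Implicit differentiation of `a t ⬝ᵥ x = 0` with the other coordinates held fixed: `a' ⬝ᵥ x + a t
i * x_i' = 0`. -/
theorem hasDerivWithinAt_solveCoord {m : ℕ} (i : Fin (m + 1)) {a : ℝ → Fin (m + 1) → ℝ}
    {a' : Fin (m + 1) → ℝ} {s : Set ℝ} {t : ℝ} (ha : HasDerivWithinAt a a' s t) (hi : a t i ≠ 0)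
    (w : Fin m → ℝ) :
    HasDerivWithinAt (fun t => solveCoord i (a t) w)
      (-(a' ⬝ᵥ solvePoint i (a t) w) / a t i) s t := by
  have h := hasDerivWithinAt_pi.1 ha
  have h1 : HasDerivWithinAt (fun t => -(∑ j, a t (i.succAbove j) * w j))
      (-(∑ j, a' (i.succAbove j) * w j)) s t := by
    refine HasDerivWithinAt.fun_neg ?_
    exact HasDerivWithinAt.fun_sum fun j _ => (h _).mul_const _
  refine (h1.div (h i) hi).congr_deriv ?_
  rw [solvePoint, dotProduct_insertNth, solveCoord]
  field_simp
  ring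

/-- The change of variables to a moving linear hyperplane, for the times at which `i` is the first
index of a nonzero coefficient. -/
theorem lintegral_lamination_isFirst {m : ℕ} (i : Fin (m + 1)) {I : Set ℝ}
    {a a' : ℝ → Fin (m + 1) → ℝ} (ham : Measurable a) (ham' : Measurable a')
    (hI : MeasurableSet I) (ha : ∀ t ∈ I, HasDerivWithinAt a (a' t) I t)
    (hfirst : ∀ t ∈ I, IsFirst (a t) i)
    {M : Set (ℝ × (Fin (m + 1) → ℝ))} (hM : MeasurableSet M) (hMI : ∀ q ∈ M, q.1 ∈ I)
    (hM0 : ∀ q ∈ M, a q.1 ⬝ᵥ q.2 = 0) (hinj : InjOn Prod.snd M)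
    {f : (Fin (m + 1) → ℝ) → ENNReal} (hf : Measurable f) :
    ∫⁻ x in Prod.snd '' M, f x = ∫⁻ t in I, leray (a t) fun x =>
      M.indicator (fun q => f q.2 * ENNReal.ofReal |a' q.1 ⬝ᵥ q.2|) (t, x) := by
  -- Lusin–Souslin: an injective measurable image of a Borel set is Borel.
  have hE : MeasurableSet (Prod.snd '' M) := hM.image_of_measurable_injOn measurable_snd hinj
  have hψ : Measurable fun p : ℝ × (Fin m → ℝ) => (p.1, solvePoint i (a p.1) p.2) :=
    measurable_fst.prodMk (measurable_solvePoint i (ham.comp measurable_fst) measurable_snd)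
  set D : Set (ℝ × (Fin m → ℝ)) := (fun p => (p.1, solvePoint i (a p.1) p.2)) ⁻¹' M with hD
  have hDm : MeasurableSet D := hψ hM
  set g : ℝ × (Fin (m + 1) → ℝ) → ENNReal :=
    M.indicator (fun q => f q.2 * ENNReal.ofReal |a' q.1 ⬝ᵥ q.2|) with hg
  have hgm : Measurable g := by
    refine Measurable.indicator ?_ hM
    refine (hf.comp measurable_snd).mul (ENNReal.measurable_ofReal.comp ?_)
    unfold dotProduct
    fun_prop
  have hgψ : ∀ (t : ℝ) (w : Fin m → ℝ), g (t, solvePoint i (a t) w) =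
      D.indicator (fun p => f (solvePoint i (a p.1) p.2) *
        ENNReal.ofReal |a' p.1 ⬝ᵥ solvePoint i (a p.1) p.2|) (t, w) := by
    intro t w
    rfl
  -- On the line parallel to the axis `i` over `w`, the swept set is the injective image of a set of
  -- times under `solveCoord`. The one-dimensional change of variables has Jacobian `|a' ⬝ᵥ x| / |a
  -- t i|`, and `1 / |a t i|` is the density in `leray`.
  have hfib : ∀ w : Fin m → ℝ,
      ∫⁻ y : ℝ, (Prod.snd '' M).indicator f (i.insertNth (α := fun _ => ℝ) y w) =
        ∫⁻ t, I.indicator (fun t => ENNReal.ofReal |a t i|⁻¹) t * g (t, solvePoint i (a t) w) := by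
    intro w
    set Dw : Set ℝ := {t | (t, w) ∈ D} with hDw
    have hDwm : MeasurableSet Dw := measurable_prodMk_right hDm
    have hDI : Dw ⊆ I := fun t ht => hMI _ ht
    have himage : ∀ y : ℝ, i.insertNth (α := fun _ => ℝ) y w ∈ Prod.snd '' M ↔
        y ∈ (fun t => solveCoord i (a t) w) '' Dw := by
      intro y
      constructor
      · rintro ⟨⟨t, x⟩, hq, hx⟩
        dsimp only at hx
        subst hx
        have h := solveCoord_eq (hfirst t (hMI _ hq)).1 (hM0 _ hq)
        refine ⟨t, ?_, h⟩
        change (t, solvePoint i (a t) w) ∈ M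
        rw [solvePoint, h]
        exact hq
      · rintro ⟨t, ht, rfl⟩
        exact ⟨_, ht, rfl⟩
    have hinjw : InjOn (fun t => solveCoord i (a t) w) Dw := by
      intro t ht t' ht' h
      have := hinj (x₁ := (t, solvePoint i (a t) w)) ht
        (x₂ := (t', solvePoint i (a t') w)) ht' (by
          dsimp only at h ⊢
          rw [solvePoint, solvePoint, h])
      exact congrArg Prod.fst this
    have himm : MeasurableSet ((fun t => solveCoord i (a t) w) '' Dw) :=
      hDwm.image_of_measurable_injOn (measurable_solveCoord i ham measurable_const) hinjw
    calc ∫⁻ y : ℝ, (Prod.snd '' M).indicator f (i.insertNth (α := fun _ => ℝ) y w)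
        = ∫⁻ y in (fun t => solveCoord i (a t) w) '' Dw,
            f (i.insertNth (α := fun _ => ℝ) y w) := by
          rw [← lintegral_indicator himm]
          refine lintegral_congr fun y => ?_
          by_cases hy : y ∈ (fun t => solveCoord i (a t) w) '' Dw
          · rw [indicator_of_mem hy, indicator_of_mem ((himage y).2 hy)]
          · rw [indicator_of_notMem hy, indicator_of_notMem fun h => hy ((himage y).1 h)]
      _ = ∫⁻ t in Dw, ENNReal.ofReal |-(a' t ⬝ᵥ solvePoint i (a t) w) / a t i| *
            f (solvePoint i (a t) w) :=
          lintegral_image_eq_lintegral_abs_deriv_mul hDwm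
            (fun t ht => (hasDerivWithinAt_solveCoord i (ha t (hDI ht))
              (hfirst t (hDI ht)).1 w).mono hDI) hinjw _
      _ = _ := by
          rw [← lintegral_indicator hDwm]
          refine lintegral_congr fun t => ?_
          by_cases ht : t ∈ Dw
          · rw [indicator_of_mem ht, indicator_of_mem (hDI ht), hgψ,
              indicator_of_mem (show (t, w) ∈ D from ht),
              abs_div, abs_neg, div_eq_inv_mul, ENNReal.ofReal_mul (by positivity)]
            ring
          · rw [indicator_of_notMem ht, hgψ, indicator_of_notMem (show (t, w) ∉ D from ht), mul_zero]
  rw [← lintegral_indicator hE, lintegral_pi_insertNth i (hf.indicator hE)]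
  simp only [hfib]
  have hmeas : Measurable fun p : ℝ × (Fin m → ℝ) =>
      I.indicator (fun t => ENNReal.ofReal |a t i|⁻¹) p.1 * g (p.1, solvePoint i (a p.1) p.2) := by
    refine Measurable.mul ?_ (hgm.comp hψ)
    refine Measurable.comp (g := I.indicator fun t => ENNReal.ofReal |a t i|⁻¹) ?_ measurable_fst
    exact Measurable.indicator (by fun_prop) hI
  rw [lintegral_lintegral_swap (f := fun (w : Fin m → ℝ) (t : ℝ) =>
      I.indicator (fun t => ENNReal.ofReal |a t i|⁻¹) t * g (t, solvePoint i (a t) w))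
      (hmeas.comp measurable_swap).aemeasurable,
    ← lintegral_indicator hI]
  refine lintegral_congr fun t => ?_
  by_cases ht : t ∈ I
  · simp only [indicator_of_mem ht]
    rw [leray_eq (hfirst t ht), lintegral_const_mul]
    exact hgm.comp (hψ.comp measurable_prodMk_left)
  · simp [indicator_of_notMem ht]

/-- The change of variables to a moving linear hyperplane: the volume element is the product of
`dt`, of the volume of the hyperplane, and of the normal velocity. -/
theorem lintegral_lamination {m : ℕ} {I : Set ℝ}
    {a a' : ℝ → Fin (m + 1) → ℝ} (ham : Measurable a) (ham' : Measurable a')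
    (hI : MeasurableSet I) (ha : ∀ t ∈ I, HasDerivWithinAt a (a' t) I t)
    (hne : ∀ t ∈ I, a t ≠ 0)
    {M : Set (ℝ × (Fin (m + 1) → ℝ))} (hM : MeasurableSet M) (hMI : ∀ q ∈ M, q.1 ∈ I)
    (hM0 : ∀ q ∈ M, a q.1 ⬝ᵥ q.2 = 0) (hinj : InjOn Prod.snd M)
    {f : (Fin (m + 1) → ℝ) → ENNReal} (hf : Measurable f) :
    ∫⁻ x in Prod.snd '' M, f x = ∫⁻ t in I, leray (a t) fun x =>
      M.indicator (fun q => f q.2 * ENNReal.ofReal |a' q.1 ⬝ᵥ q.2|) (t, x) := by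
  -- The pieces of time sharing a first nonzero index; injectivity on `M` makes the corresponding
  -- pieces of the swept set disjoint.
  set J : Fin (m + 1) → Set ℝ := fun i => I ∩ {t | IsFirst (a t) i} with hJ
  have hJm : ∀ i, MeasurableSet (J i) := fun i => hI.inter (ham (measurableSet_isFirst i))
  have hJd : Pairwise (Function.onFun Disjoint J) := fun i j hij =>
    disjoint_left.2 fun t hi hj => hij (hi.2.unique hj.2)
  have hJU : I = ⋃ i, J i := by
    ext t
    simp only [hJ, mem_iUnion, mem_inter_iff, mem_ofPred_eq]
    exact ⟨fun h => (exists_isFirst (hne t h)).imp fun i hi => ⟨h, hi⟩, fun ⟨_, h, _⟩ => h⟩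
  set N : Fin (m + 1) → Set (ℝ × (Fin (m + 1) → ℝ)) := fun i => M ∩ Prod.fst ⁻¹' J i with hN
  have hNm : ∀ i, MeasurableSet (N i) := fun i => hM.inter (measurable_fst (hJm i))
  have hNU : Prod.snd '' M = ⋃ i, Prod.snd '' N i := by
    rw [← image_iUnion]
    congr 1
    ext q
    simp only [hN, mem_iUnion, mem_inter_iff, mem_preimage]
    refine ⟨fun h => ?_, fun ⟨_, h, _⟩ => h⟩
    have := hMI q h
    rw [hJU, mem_iUnion] at this
    exact this.imp fun i hi => ⟨h, hi⟩
  have hNd : Pairwise (Function.onFun Disjoint fun i => Prod.snd '' N i) := by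
    intro i j hij
    refine disjoint_left.2 ?_
    rintro x ⟨q, hq, rfl⟩ ⟨q', hq', h⟩
    have := hinj hq'.1 hq.1 h
    subst this
    exact disjoint_left.1 (hJd hij) hq.2 hq'.2
  rw [hNU, lintegral_iUnion (fun i => (hNm i).image_of_measurable_injOn measurable_snd
    (hinj.mono inter_subset_left)) hNd]
  conv_rhs => rw [hJU]
  rw [lintegral_iUnion hJm hJd]
  refine tsum_congr fun i => ?_
  rw [lintegral_lamination_isFirst i ham ham' (hJm i)
    (fun t ht => (ha t ht.1).mono inter_subset_left) (fun t ht => ht.2) (hNm i) (fun q hq => hq.2)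
    (fun q hq => hM0 q hq.1) (hinj.mono inter_subset_left) hf]
  refine setLIntegral_congr_fun (hJm i) fun t ht => ?_
  congr 1
  ext x
  by_cases hx : (t, x) ∈ M
  · rw [indicator_of_mem hx, indicator_of_mem (show (t, x) ∈ N i from ⟨hx, ht⟩)]
  · rw [indicator_of_notMem hx, indicator_of_notMem fun h => hx h.1]


/-! ### Unimodular coordinates on a linear hyperplane. -/

theorem lintegral_comp_mulVec {m : ℕ} {A : Matrix (Fin m) (Fin m) ℝ} (hA : |A.det| = 1)
    {f : (Fin m → ℝ) → ENNReal} (hf : Measurable f) :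
    ∫⁻ x, f (A.mulVec x) = ∫⁻ x, f x := by
  have h0 : A.det ≠ 0 := by
    intro h
    simp [h] at hA
  have h := Real.map_matrix_volume_pi_eq_smul_volume_pi h0
  rw [abs_inv, hA, inv_one, ENNReal.ofReal_one, one_smul] at h
  conv_rhs => rw [← h]
  rw [lintegral_map hf (LinearMap.continuous_of_finiteDimensional _).measurable]
  rfl

theorem volume_unitInterval_affine {α : ℝ} (hα : α ≠ 0) (β : ℝ) :
    volume {q : ℝ | α * q + β ∈ Icc (0 : ℝ) 1} = ENNReal.ofReal |α|⁻¹ := by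
  have h : {q : ℝ | α * q + β ∈ Icc (0 : ℝ) 1} = (α * ·) ⁻¹' ((· + β) ⁻¹' Icc (0 : ℝ) 1) := rfl
  rw [h, Real.volume_preimage_mul_left hα, measure_preimage_add_right, Real.volume_Icc]
  simp [abs_inv]

/-- The measure on a linear hyperplane used in `leray` is the Lebesgue measure for linear
coordinates which, completed by a transversal coordinate, are unimodular. -/
theorem lintegral_comp_eq_leray {m : ℕ} {F : (Fin m → ℝ) →ₗ[ℝ] (Fin (m + 1) → ℝ)}
    {v a : Fin (m + 1) → ℝ} (hF : ∀ y, a ⬝ᵥ F y = 0) (hv : a ⬝ᵥ v = 1)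
    (hker : ∀ x, a ⬝ᵥ x = 0 → ∃ y, F y = x)
    (hA : ∀ f : (Fin (m + 1) → ℝ) → ENNReal, Measurable f →
      ∫⁻ x, f x = ∫⁻ y, ∫⁻ τ : ℝ, f (F y + τ • v))
    {g : (Fin (m + 1) → ℝ) → ENNReal} (hg : Measurable g) :
    ∫⁻ y, g (F y) = leray a g := by
  have ha : a ≠ 0 := by
    rintro rfl
    simp at hv
  obtain ⟨i, hi⟩ := exists_isFirst ha
  rw [leray_eq hi]
  have hFm : Measurable F := F.continuous_of_finiteDimensional.measurable
  -- The projection onto the hyperplane along the axis `i`.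
  set p : (Fin (m + 1) → ℝ) → (Fin (m + 1) → ℝ) := fun x => x - (a ⬝ᵥ x / a i) • Pi.single i 1
  have hdm : Measurable fun x : Fin (m + 1) → ℝ => a ⬝ᵥ x := by
    unfold dotProduct
    fun_prop
  have hpm : Measurable p := measurable_id.sub ((hdm.div_const _).smul_const _)
  -- A test function on the slab `0 ≤ a ⬝ᵥ x ≤ 1`. Integrating it along `v` gives the left side;
  -- integrating it along the axis `i`, where the slab has length `1 / |a i|`, gives the right side.
  set G : (Fin (m + 1) → ℝ) → ENNReal := fun x =>
    (Icc (0 : ℝ) 1).indicator 1 (a ⬝ᵥ x) * g (p x)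
  have hind : Measurable ((Icc (0 : ℝ) 1).indicator (1 : ℝ → ENNReal)) :=
    Measurable.indicator measurable_one measurableSet_Icc
  have hGm : Measurable G := (hind.comp hdm).mul (hg.comp hpm)
  have h1 : ∫⁻ x, G x = ∫⁻ y, g (F y) := by
    -- Both `v` and `Pi.single i 1 / a i` have `a`-coordinate `1`, so they differ by a vector `F y₀`
    -- of the hyperplane. The two fibrations of the slab differ by the shear `y ↦ y + τ • y₀`, which
    -- translation invariance removes.
    obtain ⟨y₀, hy₀⟩ := hker (v - (a i)⁻¹ • Pi.single i 1) (by
      rw [dotProduct_sub, dotProduct_smul, hv, dotProduct_single]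
      simp [hi.1])
    have hG : ∀ (y : Fin m → ℝ) (τ : ℝ),
        G (F y + τ • v) = (Icc (0 : ℝ) 1).indicator 1 τ * g (F (y + τ • y₀)) := by
      intro y τ
      have hd : a ⬝ᵥ (F y + τ • v) = τ := by
        rw [dotProduct_add, hF, dotProduct_smul, hv]
        simp
      have hp : p (F y + τ • v) = F (y + τ • y₀) := by
        simp only [p, hd]
        rw [map_add, map_smul, hy₀, smul_sub, smul_smul, div_eq_mul_inv]
        abel
      simp only [G, hd, hp]
    rw [hA G hGm]
    simp only [hG]
    rw [lintegral_lintegral_swap]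
    · have : ∀ τ : ℝ, ∫⁻ y, (Icc (0 : ℝ) 1).indicator 1 τ * g (F (y + τ • y₀)) =
          (Icc (0 : ℝ) 1).indicator 1 τ * ∫⁻ y, g (F y) := by
        intro τ
        rw [lintegral_const_mul _ (show Measurable fun y => g (F (y + τ • y₀)) from
          hg.comp (hFm.comp (measurable_add_const _))),
          lintegral_add_right_eq_self fun y => g (F y)]
      simp only [this]
      rw [lintegral_mul_const _ hind, lintegral_indicator_one measurableSet_Icc]
      simp
    · refine Measurable.aemeasurable ?_
      unfold Function.uncurry
      exact (hind.comp measurable_snd).mul (hg.comp (hFm.comp (by fun_prop)))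
  rw [← h1, lintegral_pi_insertNth i hGm, ← lintegral_const_mul]
  · refine lintegral_congr fun w => ?_
    have hG : ∀ q : ℝ, G (i.insertNth (α := fun _ => ℝ) q w) =
        {q : ℝ | a i * q + ∑ j, a (i.succAbove j) * w j ∈ Icc (0 : ℝ) 1}.indicator 1 q *
          g (solvePoint i a w) := by
      intro q
      have hp : p (i.insertNth (α := fun _ => ℝ) q w) = solvePoint i a w := by
        simp only [p, dotProduct_insertNth]
        ext j
        refine Fin.succAboveCases i ?_ (fun j => ?_) j
        · simp only [solvePoint, solveCoord, Pi.sub_apply, Fin.insertNth_apply_same, Pi.smul_apply,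
            Pi.single_eq_same, smul_eq_mul]
          have := hi.1
          field_simp
          ring
        · simp [solvePoint, Fin.succAbove_ne]
      simp only [G, hp, dotProduct_insertNth]
      rfl
    have hS : MeasurableSet {q : ℝ | a i * q + ∑ j, a (i.succAbove j) * w j ∈ Icc (0 : ℝ) 1} :=
      measurableSet_Icc.preimage (by fun_prop)
    simp only [hG]
    rw [lintegral_mul_const _ (measurable_one.indicator hS), lintegral_indicator_one hS,
      volume_unitInterval_affine hi.1]
  · exact hg.comp (measurable_solvePoint i measurable_const measurable_id)

/-! ### Volume and homogeneous coordinates -/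

/-- The point of `ℝ^(k+1)` over `u ∈ ℝ^k` with last coordinate `y`. -/
noncomputable def join {k : ℕ} (u : EuclideanSpace ℝ (Fin k)) (y : ℝ) : Ambient k :=
  WithLp.toLp 2 (Fin.snoc (α := fun _ => ℝ) (fun i => u i) y)

@[simp]
theorem join_castSucc {k : ℕ} (u : EuclideanSpace ℝ (Fin k)) (y : ℝ) (i : Fin k) :
    join u y i.castSucc = u i := by
  simp [join]

@[simp]
theorem join_last {k : ℕ} (u : EuclideanSpace ℝ (Fin k)) (y : ℝ) :
    join u y (Fin.last k) = y := by
  simp [join]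

theorem ambient_ext {k : ℕ} {a b : Ambient k} (h : ∀ i : Fin k, a i.castSucc = b i.castSucc)
    (h' : a (Fin.last k) = b (Fin.last k)) : a = b := by
  ext i
  exact Fin.lastCases h' h i

/-- `join` as a linear map. -/
noncomputable def joinL (k : ℕ) : EuclideanSpace ℝ (Fin k) × ℝ →L[ℝ] Ambient k :=
  LinearMap.toContinuousLinearMap
    { toFun := fun p => join p.1 p.2
      map_add' := fun p q => ambient_ext (by simp) (by simp)
      map_smul' := fun s p => ambient_ext (by simp) (by simp) }

theorem measurable_join {k : ℕ} :
    Measurable fun p : EuclideanSpace ℝ (Fin k) × ℝ => join p.1 p.2 :=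
  (joinL k).continuous.measurable

theorem smul_join {k : ℕ} (s : ℝ) (u : EuclideanSpace ℝ (Fin k)) (y : ℝ) :
    s • join u y = join (s • u) (s * y) :=
  ambient_ext (by simp) (by simp)

theorem form_join (X : Geometry) {k : ℕ} (u w : EuclideanSpace ℝ (Fin k)) (p q : ℝ) :
    form X (join u p) (join w q) = inner ℝ u w + X.delta * (p * q) := by
  simp only [form, join_castSucc, join_last, PiLp.inner_apply]
  congr 1
  exact Finset.sum_congr rfl fun i _ => by simp [mul_comm]

theorem lintegral_euclidean {ι : Type*} [Fintype ι] (f : EuclideanSpace ℝ ι → ENNReal) :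
    ∫⁻ x, f x = ∫⁻ x : ι → ℝ, f (WithLp.toLp 2 x) :=
  ((PiLp.volume_preserving_toLp ι).lintegral_comp_emb
    (MeasurableEquiv.toLp 2 (ι → ℝ)).measurableEmbedding f).symm

theorem lintegral_join {k : ℕ} {f : Ambient k → ENNReal} (hf : Measurable f) :
    ∫⁻ x, f x = ∫⁻ u, ∫⁻ y, f (join u y) := by
  rw [lintegral_euclidean, lintegral_euclidean, lintegral_pi_insertNth (Fin.last k)]
  · simp only [Fin.insertNth_last']
    rfl
  · exact hf.comp (MeasurableEquiv.toLp 2 (Fin (k + 1) → ℝ)).measurable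

/-! ### The graph charts and their volume density. -/

theorem graphParam_eq (X : Geometry) {k : ℕ} (σ : ℝ) (x : EuclideanSpace ℝ (Fin k)) :
    graphParam X k σ x = join x (σ * height X x) := rfl

theorem continuous_height (X : Geometry) {k : ℕ} :
    Continuous fun x : EuclideanSpace ℝ (Fin k) => height X x := by
  cases X <;> unfold height <;> fun_prop

theorem measurable_graphParam (X : Geometry) (k : ℕ) (σ : ℝ) : Measurable (graphParam X k σ) :=
  ((joinL k).continuous.comp (continuous_id.prodMk
    (continuous_const.mul (continuous_height X)))).measurable

theorem measurableSet_chartDomain (X : Geometry) (k : ℕ) : MeasurableSet (chartDomain X k) := by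
  cases X
  · exact MeasurableSet.univ
  · exact (isOpen_lt continuous_norm continuous_const).measurableSet
  · exact MeasurableSet.univ

theorem height_pos {X : Geometry} {k : ℕ} {x : EuclideanSpace ℝ (Fin k)}
    (hx : x ∈ chartDomain X k) : 0 < height X x := by
  cases X
  · exact one_pos
  · have h : ‖x‖ < 1 := hx
    exact Real.sqrt_pos.2 (by nlinarith [norm_nonneg x])
  · exact Real.sqrt_pos.2 (by positivity)

theorem sq_of_mem_sheets {X : Geometry} {σ : ℝ} (hσ : σ ∈ sheets X) : σ ^ 2 = 1 := by
  cases X <;> simp only [sheets, Finset.mem_singleton, Finset.mem_insert] at hσ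
  · simp [hσ]
  · rcases hσ with h | h <;> simp [h]
  · simp [hσ]

theorem spherical_height_sq {k : ℕ} {x : EuclideanSpace ℝ (Fin k)} (hx : ‖x‖ < 1) :
    height .spherical x ^ 2 = 1 - ‖x‖ ^ 2 :=
  Real.sq_sqrt (by nlinarith [norm_nonneg x])

theorem hyperbolic_height_sq {k : ℕ} (x : EuclideanSpace ℝ (Fin k)) :
    height .hyperbolic x ^ 2 = 1 + ‖x‖ ^ 2 :=
  Real.sq_sqrt (by positivity)

theorem graphParam_mem_space {X : Geometry} {k : ℕ} {σ : ℝ} (hσ : σ ∈ sheets X)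
    {x : EuclideanSpace ℝ (Fin k)} (hx : x ∈ chartDomain X k) : graphParam X k σ x ∈ space X k := by
  have h2 := sq_of_mem_sheets hσ
  have hpos := height_pos hx
  rw [graphParam_eq]
  cases X
  · have : σ = 1 := by simpa [sheets] using hσ
    simp [space, this, height]
  · have := spherical_height_sq (show ‖x‖ < 1 from hx)
    simp only [space, mem_ofPred_eq, form_join, real_inner_self_eq_norm_sq, Geometry.delta]
    linear_combination (height .spherical x) ^ 2 * h2 + this
  · have h1 : σ = 1 := by simpa [sheets] using hσ
    have := hyperbolic_height_sq x
    simp only [space, mem_ofPred_eq, form_join, real_inner_self_eq_norm_sq, Geometry.delta, join_last,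
      h1, one_mul]
    exact ⟨by linarith, hpos⟩

/-- The derivative of the height. -/
noncomputable def heightDeriv (X : Geometry) {k : ℕ} (x : EuclideanSpace ℝ (Fin k)) :
    EuclideanSpace ℝ (Fin k) →L[ℝ] ℝ :=
  match X with
  | .euclidean => 0
  | .spherical => -(height .spherical x)⁻¹ • innerSL ℝ x
  | .hyperbolic => (height .hyperbolic x)⁻¹ • innerSL ℝ x

theorem hasFDerivAt_height {X : Geometry} {k : ℕ} {x : EuclideanSpace ℝ (Fin k)}
    (hx : x ∈ chartDomain X k) : HasFDerivAt (height X) (heightDeriv X x) x := by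
  have hpos := height_pos hx
  have hsq : HasFDerivAt (fun x : EuclideanSpace ℝ (Fin k) => ‖x‖ ^ 2) (2 • innerSL ℝ x) x :=
    (hasStrictFDerivAt_norm_sq x).hasFDerivAt
  cases X
  · exact hasFDerivAt_const _ _
  · have h := (hsq.const_sub 1).sqrt (Real.sqrt_pos.1 hpos).ne'
    refine h.congr_fderiv ?_
    ext v
    simp [heightDeriv, height]
    ring
  · have h := (hsq.const_add 1).sqrt (Real.sqrt_pos.1 hpos).ne'
    refine h.congr_fderiv ?_
    ext v
    simp [heightDeriv, height]
    ring

theorem hasFDerivAt_graphParam {X : Geometry} {k : ℕ} (σ : ℝ) {x : EuclideanSpace ℝ (Fin k)}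
    (hx : x ∈ chartDomain X k) :
    HasFDerivAt (graphParam X k σ)
      ((joinL k).comp ((ContinuousLinearMap.id ℝ _).prod (σ • heightDeriv X x))) x :=
  (joinL k).hasFDerivAt.comp x ((hasFDerivAt_id x).prodMk ((hasFDerivAt_height hx).const_smul σ))

theorem fderiv_graphParam {X : Geometry} {k : ℕ} (σ : ℝ) {x : EuclideanSpace ℝ (Fin k)}
    (hx : x ∈ chartDomain X k) (v : EuclideanSpace ℝ (Fin k)) :
    fderiv ℝ (graphParam X k σ) x v = join v (σ * heightDeriv X x v) := by
  rw [(hasFDerivAt_graphParam σ hx).fderiv]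
  rfl

/-- The Gram matrix is the rank-one perturbation `1 + δ d dᵀ` of the identity, `d` being the
gradient of the height and `σ² = 1`. Its determinant is `1 + δ |d|²`, which the equation of the
quadric turns into `h⁻²`. -/
theorem det_gram_graphParam {X : Geometry} {k : ℕ} {σ : ℝ} (hσ : σ ∈ sheets X)
    {x : EuclideanSpace ℝ (Fin k)} (hx : x ∈ chartDomain X k) :
    (gram X (graphParam X k σ) x).det = (height X x)⁻¹ ^ 2 := by
  have h2 := sq_of_mem_sheets hσ
  have hpos := height_pos hx
  set d : Fin k → ℝ := fun i => heightDeriv X x (EuclideanSpace.single i 1) with hd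
  have h : gram X (graphParam X k σ) x =
      1 + Matrix.replicateCol Unit (X.delta • d) * Matrix.replicateRow Unit d := by
    ext i j
    simp only [gram, Matrix.of_apply, fderiv_graphParam σ hx, form_join, Matrix.add_apply,
      Matrix.mul_apply, Matrix.replicateCol_apply, Matrix.replicateRow_apply, Finset.univ_unique,
      Finset.sum_singleton, Pi.smul_apply, smul_eq_mul, Matrix.one_apply, hd,
      EuclideanSpace.inner_single_left, PiLp.single_apply]
    simp only [map_one, one_mul]
    linear_combination (X.delta * heightDeriv X x (EuclideanSpace.single i 1) *
      heightDeriv X x (EuclideanSpace.single j 1)) * h2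
  rw [h, Matrix.det_one_add_replicateCol_mul_replicateRow, dotProduct_smul]
  have hn : ∑ i, x i * x i = ‖x‖ ^ 2 := by
    rw [EuclideanSpace.real_norm_sq_eq]
    exact Finset.sum_congr rfl fun i _ => (sq _).symm
  have hx' : ∀ i, inner ℝ x (EuclideanSpace.single i (1 : ℝ)) = x i := fun i => by
    simp [EuclideanSpace.inner_single_right]
  cases X
  · simp [hd, heightDeriv, height]
  · have h1 := spherical_height_sq (show ‖x‖ < 1 from hx)
    have hdd : d = (-(height .spherical x)⁻¹) • fun i => x i := by
      ext i
      simp [hd, heightDeriv, hx']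
    rw [hdd, smul_dotProduct, dotProduct_smul]
    simp only [dotProduct, hn, Geometry.delta, smul_eq_mul]
    field_simp
    linarith
  · have h1 := hyperbolic_height_sq x
    have hdd : d = ((height .hyperbolic x)⁻¹) • fun i => x i := by
      ext i
      simp [hd, heightDeriv, hx']
    rw [hdd, smul_dotProduct, dotProduct_smul]
    simp only [dotProduct, hn, Geometry.delta, smul_eq_mul]
    field_simp
    linarith

/-- The Gram density is only computed on the domain `U`; the explicit measurable `w` replaces it
there. -/
theorem lintegral_patchVolume (X : Geometry) {j k : ℕ} {r : EuclideanSpace ℝ (Fin j) → Ambient k}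
    (hr : Measurable r) {U : Set (EuclideanSpace ℝ (Fin j))} (hU : MeasurableSet U)
    {w : EuclideanSpace ℝ (Fin j) → ENNReal} (hw : Measurable w)
    (hwU : ∀ s ∈ U, ENNReal.ofReal (Real.sqrt |(gram X r s).det|) = w s)
    {G : Ambient k → ENNReal} (hG : Measurable G) :
    ∫⁻ x, G x ∂(patchVolume X r U) = ∫⁻ s in U, w s * G (r s) := by
  have h : (fun s => ENNReal.ofReal (Real.sqrt |(gram X r s).det|)) =ᵐ[volume.restrict U] w :=
    (ae_restrict_iff' hU).2 (Filter.Eventually.of_forall hwU)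
  rw [patchVolume, withDensity_congr_ae h, lintegral_map hG hr]
  exact lintegral_withDensity_eq_lintegral_mul _ hw (hG.comp hr)

theorem sqrt_det_gram_graphParam {X : Geometry} {k : ℕ} {σ : ℝ} (hσ : σ ∈ sheets X)
    {x : EuclideanSpace ℝ (Fin k)} (hx : x ∈ chartDomain X k) :
    Real.sqrt |(gram X (graphParam X k σ) x).det| = (height X x)⁻¹ := by
  rw [det_gram_graphParam hσ hx, abs_of_nonneg (by positivity),
    Real.sqrt_sq (inv_nonneg.2 (height_pos hx).le)]

theorem lintegral_spaceVolume (X : Geometry) {k : ℕ} {G : Ambient k → ENNReal} (hG : Measurable G) :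
    ∫⁻ x, G x ∂(spaceVolume X k) = ∑ σ ∈ sheets X, ∫⁻ u in chartDomain X k,
      ENNReal.ofReal (height X u)⁻¹ * G (join u (σ * height X u)) := by
  rw [spaceVolume, lintegral_finsetSum_measure]
  refine Finset.sum_congr rfl fun σ hσ => ?_
  exact lintegral_patchVolume X (measurable_graphParam X k σ) (measurableSet_chartDomain X k)
    (ENNReal.measurable_ofReal.comp (continuous_height X).measurable.inv)
    (fun s hs => by rw [sqrt_det_gram_graphParam hσ hs]; rfl) hG


/-- The last coordinates of the points `s • r`, `s > 0`, lying over `u`, where `r` is in the graph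
that parametrizes `X^k`. -/
def ray (X : Geometry) {k : ℕ} (u : EuclideanSpace ℝ (Fin k)) : Set ℝ :=
  match X with
  | .euclidean => Ioi 0
  | .spherical => Ioi 0
  | .hyperbolic => Ioi ‖u‖

/-- For `y = s h(u / s)` one has `y² = s² - δ ‖u‖²` in the curved cases, hence `y y' = s` and `y' =
s / y = 1 / h`. In the Euclidean case `y = s`. This is exactly the volume density of the chart. -/
theorem hasDerivAt_mul_height_smul {X : Geometry} {k : ℕ} {u : EuclideanSpace ℝ (Fin k)} {s : ℝ}
    (hs : 0 < s) (hu : s⁻¹ • u ∈ chartDomain X k) :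
    HasDerivAt (fun s => s * height X (s⁻¹ • u)) (height X (s⁻¹ • u))⁻¹ s := by
  have hpos := height_pos hu
  have hinv : HasDerivAt (fun s : ℝ => s⁻¹ • u) (-(s ^ 2)⁻¹ • u) s :=
    (hasDerivAt_inv hs.ne').smul_const u
  have h := (hasDerivAt_id s).mul ((hasFDerivAt_height hu).comp_hasDerivAt s hinv)
  refine h.congr_deriv ?_
  cases X
  · simp [heightDeriv, height]
  · have h1 := spherical_height_sq (show ‖s⁻¹ • u‖ < 1 from hu)
    rw [norm_smul, norm_inv, Real.norm_of_nonneg hs.le] at h1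
    simp only [heightDeriv, id, smul_apply, innerSL_apply_apply, inner_smul_left,
      inner_smul_right, real_inner_self_eq_norm_sq, smul_eq_mul, Function.comp_apply, one_mul]
    simp only [map_inv₀, conj_trivial]
    generalize height .spherical (s⁻¹ • u) = H at h1 hpos ⊢
    field_simp
    field_simp at h1
    linarith
  · have h1 := hyperbolic_height_sq (s⁻¹ • u)
    rw [norm_smul, norm_inv, Real.norm_of_nonneg hs.le] at h1
    simp only [heightDeriv, id, smul_apply, innerSL_apply_apply, inner_smul_left,
      inner_smul_right, real_inner_self_eq_norm_sq, smul_eq_mul, Function.comp_apply, one_mul]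
    simp only [map_inv₀, conj_trivial]
    generalize height .hyperbolic (s⁻¹ • u) = H at h1 hpos ⊢
    field_simp
    field_simp at h1
    linarith

theorem spherical_mul_height_sq {k : ℕ} {u : EuclideanSpace ℝ (Fin k)} {s : ℝ}
    (hs : 0 < s) (hu : s⁻¹ • u ∈ chartDomain .spherical k) :
    (s * height .spherical (s⁻¹ • u)) ^ 2 = s ^ 2 - ‖u‖ ^ 2 := by
  rw [mul_pow, spherical_height_sq hu, norm_smul, norm_inv, Real.norm_of_nonneg hs.le]
  field_simp

theorem hyperbolic_mul_height_sq {k : ℕ} (u : EuclideanSpace ℝ (Fin k)) {s : ℝ} (hs : 0 < s) :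
    (s * height .hyperbolic (s⁻¹ • u)) ^ 2 = s ^ 2 + ‖u‖ ^ 2 := by
  rw [mul_pow, hyperbolic_height_sq, norm_smul, norm_inv, Real.norm_of_nonneg hs.le]
  field_simp

theorem injOn_mul_height_smul (X : Geometry) {k : ℕ} (u : EuclideanSpace ℝ (Fin k)) :
    InjOn (fun s => s * height X (s⁻¹ • u)) {s | 0 < s ∧ s⁻¹ • u ∈ chartDomain X k} := by
  rintro s ⟨hs, hsu⟩ t ⟨ht, htu⟩ h
  dsimp only at h
  cases X
  · simpa [height] using h
  · have h2 := spherical_mul_height_sq ht htu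
    rw [← h, spherical_mul_height_sq hs hsu] at h2
    exact (pow_left_inj₀ hs.le ht.le two_ne_zero).1 (by linarith)
  · have h2 := hyperbolic_mul_height_sq u ht
    rw [← h, hyperbolic_mul_height_sq u hs] at h2
    exact (pow_left_inj₀ hs.le ht.le two_ne_zero).1 (by linarith)

theorem image_mul_height_smul (X : Geometry) {k : ℕ} (u : EuclideanSpace ℝ (Fin k)) :
    (fun s => s * height X (s⁻¹ • u)) '' {s | 0 < s ∧ s⁻¹ • u ∈ chartDomain X k} = ray X u := by
  ext y
  constructor
  · rintro ⟨s, ⟨hs, hsu⟩, rfl⟩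
    have hpos := mul_pos hs (height_pos hsu)
    cases X
    · exact hpos
    · exact hpos
    · have h2 := hyperbolic_mul_height_sq u hs
      exact lt_of_pow_lt_pow_left₀ 2 hpos.le (by nlinarith [norm_nonneg u])
  · intro hy
    cases X
    · exact ⟨y, ⟨hy, mem_univ _⟩, by simp [height]⟩
    · have hy0 : 0 < y := hy
      have hs : 0 < Real.sqrt (y ^ 2 + ‖u‖ ^ 2) := Real.sqrt_pos.2 (by positivity)
      have hs2 : Real.sqrt (y ^ 2 + ‖u‖ ^ 2) ^ 2 = y ^ 2 + ‖u‖ ^ 2 := Real.sq_sqrt (by positivity)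
      have hsu : (Real.sqrt (y ^ 2 + ‖u‖ ^ 2))⁻¹ • u ∈ chartDomain .spherical k := by
        change ‖_‖ < 1
        rw [norm_smul, norm_inv, Real.norm_of_nonneg hs.le, inv_mul_lt_one₀ hs]
        exact Real.lt_sqrt_of_sq_lt (by nlinarith)
      refine ⟨_, ⟨hs, hsu⟩, ?_⟩
      have h2 := spherical_mul_height_sq hs hsu
      exact (pow_left_inj₀ (mul_pos hs (height_pos hsu)).le hy0.le two_ne_zero).1 (by
        rw [h2, hs2]; ring)
    · have hy0 : ‖u‖ < y := hy
      have hn := norm_nonneg u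
      have hlt : 0 < y ^ 2 - ‖u‖ ^ 2 := by nlinarith
      have hs : 0 < Real.sqrt (y ^ 2 - ‖u‖ ^ 2) := Real.sqrt_pos.2 hlt
      have hs2 : Real.sqrt (y ^ 2 - ‖u‖ ^ 2) ^ 2 = y ^ 2 - ‖u‖ ^ 2 := Real.sq_sqrt hlt.le
      refine ⟨_, ⟨hs, mem_univ _⟩, ?_⟩
      have h2 := hyperbolic_mul_height_sq u hs
      exact (pow_left_inj₀ (mul_pos hs (height_pos (X := .hyperbolic) (mem_univ _))).le
        (hn.trans hy0.le) two_ne_zero).1 (by rw [h2, hs2]; ring)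

theorem lintegral_comp_smul_mul {k : ℕ} {s : ℝ} (hs : 0 < s)
    {f : EuclideanSpace ℝ (Fin k) → ENNReal} (hf : Measurable f) :
    ENNReal.ofReal (s ^ k) * ∫⁻ u, f u = ∫⁻ u, f (s⁻¹ • u) := by
  have h := Measure.map_addHaar_smul (volume : Measure (EuclideanSpace ℝ (Fin k)))
    (inv_ne_zero hs.ne')
  rw [← lintegral_map hf (measurable_const_smul _), h, lintegral_smul_measure, finrank_euclideanSpace,
    Fintype.card_fin, inv_pow, inv_inv, abs_of_pos (pow_pos hs k), smul_eq_mul]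

/-- Integration in homogeneous coordinates over the cone spanned by the graph that parametrizes
`X^k`. -/
theorem lintegral_cone_chart (X : Geometry) {k : ℕ} (σ : ℝ)
    {f : Ambient k → ENNReal} (hf : Measurable f) :
    ∫⁻ u in chartDomain X k, ENNReal.ofReal (height X u)⁻¹ * ∫⁻ s in Ioi (0 : ℝ),
        ENNReal.ofReal (s ^ k) * f (s • join u (σ * height X u)) =
      ∫⁻ u, ∫⁻ y in ray X u, f (join u (σ * y)) := by
  have hU := measurableSet_chartDomain X k
  have hmh : Measurable fun u : EuclideanSpace ℝ (Fin k) => height X u :=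
    (continuous_height X).measurable
  -- The map `(u, s) ↦ s • r` is undone in two substitutions: at fixed `s`, replacing `u` by `s⁻¹ •
  -- u` absorbs `s^k`; then at fixed `u`, passing from `s` to the last coordinate absorbs `1 / h`.
  set B : EuclideanSpace ℝ (Fin k) × ℝ → ENNReal := fun p => (chartDomain X k).indicator
    (fun u => ENNReal.ofReal (height X u)⁻¹) p.1 * f (p.2 • join p.1 (σ * height X p.1)) with hB
  have hBm : Measurable B := by
    refine Measurable.mul ?_ (hf.comp (measurable_snd.smul (measurable_join.comp
      (measurable_fst.prodMk (by fun_prop)))))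
    exact (hmh.inv.ennreal_ofReal.indicator hU).comp measurable_fst
  have hfib : ∀ u : EuclideanSpace ℝ (Fin k),
      ∫⁻ s in Ioi (0 : ℝ), B (s⁻¹ • u, s) = ∫⁻ y in ray X u, f (join u (σ * y)) := by
    intro u
    have hDm : MeasurableSet {s : ℝ | 0 < s ∧ s⁻¹ • u ∈ chartDomain X k} :=
      measurableSet_Ioi.inter (hU.preimage (measurable_inv.smul_const u))
    rw [← image_mul_height_smul X u, lintegral_image_eq_lintegral_abs_deriv_mul hDm
      (fun s hs => (hasDerivAt_mul_height_smul hs.1 hs.2).hasDerivWithinAt)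
      (injOn_mul_height_smul X u), ← lintegral_indicator hDm, ← lintegral_indicator measurableSet_Ioi]
    refine lintegral_congr fun s => ?_
    by_cases hs : 0 < s
    · rw [indicator_of_mem (show s ∈ Ioi (0 : ℝ) from hs)]
      by_cases hu : s⁻¹ • u ∈ chartDomain X k
      · rw [indicator_of_mem (show s ∈ {s : ℝ | 0 < s ∧ s⁻¹ • u ∈ chartDomain X k} from ⟨hs, hu⟩)]
        simp only [hB, indicator_of_mem hu, abs_of_pos (inv_pos.2 (height_pos hu)), smul_join,
          smul_inv_smul₀ hs.ne', mul_left_comm s σ]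
      · rw [indicator_of_notMem fun h => hu h.2]
        simp [hB, indicator_of_notMem hu]
    · rw [indicator_of_notMem (show s ∉ Ioi (0 : ℝ) from hs), indicator_of_notMem fun h => hs h.1]
  simp only [← hfib]
  have h1 : ∀ u, (chartDomain X k).indicator (fun u => ENNReal.ofReal (height X u)⁻¹ *
      ∫⁻ s in Ioi (0 : ℝ), ENNReal.ofReal (s ^ k) * f (s • join u (σ * height X u))) u =
      ∫⁻ s in Ioi (0 : ℝ), ENNReal.ofReal (s ^ k) * B (u, s) := by
    intro u
    by_cases hu : u ∈ chartDomain X k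
    · simp only [hB, indicator_of_mem hu, mul_left_comm (ENNReal.ofReal (_ ^ k))]
      rw [lintegral_const_mul]
      exact Measurable.mul (by fun_prop) (hf.comp (measurable_id.smul_const _))
    · simp [hB, indicator_of_notMem hu]
  rw [← lintegral_indicator hU]
  simp only [h1]
  have hm1 : Measurable fun p : EuclideanSpace ℝ (Fin k) × ℝ =>
      ENNReal.ofReal (p.2 ^ k) * B (p.1, p.2) := Measurable.mul (by fun_prop) hBm
  have hm2 : Measurable fun p : EuclideanSpace ℝ (Fin k) × ℝ => B (p.2⁻¹ • p.1, p.2) :=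
    hBm.comp ((measurable_snd.inv.smul measurable_fst).prodMk measurable_snd)
  rw [lintegral_lintegral_swap (f := fun u s => ENNReal.ofReal (s ^ k) * B (u, s))
    hm1.aemeasurable, lintegral_lintegral_swap (f := fun u s => B (s⁻¹ • u, s)) hm2.aemeasurable]
  refine setLIntegral_congr_fun measurableSet_Ioi fun s hs => ?_
  rw [lintegral_const_mul _ (show Measurable fun u => B (u, s) from
    hBm.comp measurable_prodMk_right)]
  exact lintegral_comp_smul_mul hs (f := fun u => B (u, s)) (hBm.comp measurable_prodMk_right)

/-- The function on the cone spanned by `X^k` which is `φ(m) G(r)` at the material vector `m r`. -/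
noncomputable def radial (X : Geometry) {k : ℕ} (φ : ℝ → ENNReal) (G : Ambient k → ENNReal)
    (x : Ambient k) : ENNReal :=
  if 0 < materialMass X x then φ (materialMass X x) * G ((materialMass X x)⁻¹ • x) else 0

theorem continuous_form (X : Geometry) {k : ℕ} {Z : Type*} [TopologicalSpace Z]
    {a b : Z → Ambient k} (ha : Continuous a) (hb : Continuous b) :
    Continuous fun z => form X (a z) (b z) := by
  unfold form
  fun_prop

theorem continuous_materialMass (X : Geometry) {k : ℕ} :
    Continuous fun x : Ambient k => materialMass X x := by
  cases X
  · unfold materialMass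
    fun_prop
  · exact (continuous_form _ continuous_id continuous_id).sqrt
  · exact (continuous_form _ continuous_id continuous_id).neg.sqrt

theorem measurable_normalize (X : Geometry) {k : ℕ} :
    Measurable fun x : Ambient k => (materialMass X x)⁻¹ • x :=
  (continuous_materialMass X).measurable.inv.smul measurable_id

theorem measurable_radial (X : Geometry) {k : ℕ} {φ : ℝ → ENNReal} (hφ : Measurable φ)
    {G : Ambient k → ENNReal} (hG : Measurable G) : Measurable (radial X φ G) := by
  have hm := (continuous_materialMass X (k := k)).measurable
  exact Measurable.ite (measurableSet_lt measurable_const hm)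
    ((hφ.comp hm).mul (hG.comp (measurable_normalize X))) measurable_const

theorem radial_smul (X : Geometry) {k : ℕ} (φ : ℝ → ENNReal) (G : Ambient k → ENNReal) {s : ℝ}
    (hs : 0 < s) {r : Ambient k} (hr : r ∈ space X k) :
    radial X φ G (s • r) = φ s * G r := by
  rw [radial, materialMass_smul X hs.le hr, if_pos hs, inv_smul_smul₀ hs.ne']

/-- In the hyperbolic case the material mass is positive on the backward cone too. Points there
normalize to points with last coordinate at most `0`, outside the space, where `G` vanishes. -/
theorem radial_join_eq_zero {k : ℕ} {φ : ℝ → ENNReal} {G : Ambient k → ENNReal} {X : Geometry}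
    (hX : X ≠ .spherical) (hG : ∀ r, r ∉ space X k → G r = 0) {u : EuclideanSpace ℝ (Fin k)} {y : ℝ}
    (hy : y ∉ ray X u) : radial X φ G (join u y) = 0 := by
  cases X
  · have : ¬ 0 < materialMass .euclidean (join u y) := by
      simpa [materialMass, ray] using hy
    rw [radial, if_neg this]
  · exact absurd rfl hX
  · unfold radial
    split_ifs with h
    · rw [hG, mul_zero]
      intro hmem
      apply hy
      have hsq : 0 < -form .hyperbolic (join u y) (join u y) := Real.sqrt_pos.1 h
      have hlast := hmem.2
      rw [PiLp.smul_apply, join_last, smul_eq_mul] at hlast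
      have hy0 : 0 < y := by
        by_contra hle
        exact absurd hlast (not_lt.2 (mul_nonpos_of_nonneg_of_nonpos (inv_nonneg.2 h.le)
          (not_lt.1 hle)))
      rw [form_join, real_inner_self_eq_norm_sq] at hsq
      simp only [Geometry.delta] at hsq
      exact lt_of_pow_lt_pow_left₀ 2 hy0.le (by linarith)
    · rfl

/-- Integration in homogeneous coordinates over the cone spanned by `X^k`. -/
theorem lintegral_radial (X : Geometry) {k : ℕ} {φ : ℝ → ENNReal} (hφ : Measurable φ)
    {G : Ambient k → ENNReal} (hG : Measurable G) (hG0 : ∀ r, r ∉ space X k → G r = 0) :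
    ∫⁻ x, radial X φ G x =
      (∫⁻ s in Ioi (0 : ℝ), ENNReal.ofReal (s ^ k) * φ s) * ∫⁻ r, G r ∂(spaceVolume X k) := by
  have hR := measurable_radial X hφ hG
  have hmh : Measurable fun u : EuclideanSpace ℝ (Fin k) => height X u :=
    (continuous_height X).measurable
  have key : (∫⁻ s in Ioi (0 : ℝ), ENNReal.ofReal (s ^ k) * φ s) * ∫⁻ r, G r ∂(spaceVolume X k) =
      ∑ σ ∈ sheets X, ∫⁻ u, ∫⁻ y in ray X u, radial X φ G (join u (σ * y)) := by
    rw [lintegral_spaceVolume X hG, Finset.mul_sum]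
    refine Finset.sum_congr rfl fun σ hσ => ?_
    rw [← lintegral_cone_chart X σ hR, ← lintegral_const_mul]
    · refine setLIntegral_congr_fun (measurableSet_chartDomain X k) fun u hu => ?_
      have hmem := graphParam_mem_space hσ hu
      rw [graphParam_eq] at hmem
      have hφm : Measurable fun s : ℝ => ENNReal.ofReal (s ^ k) * φ s :=
        Measurable.mul (by fun_prop) hφ
      rw [mul_left_comm, ← lintegral_mul_const _ hφm]
      congr 1
      refine setLIntegral_congr_fun measurableSet_Ioi fun s hs => ?_
      rw [radial_smul X φ G hs hmem, mul_assoc]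
    · exact hmh.inv.ennreal_ofReal.mul (hG.comp (measurable_join.comp
        (measurable_id.prodMk (by fun_prop))))
  rw [key, lintegral_join hR]
  have hfull : X ≠ .spherical → ∀ u : EuclideanSpace ℝ (Fin k), MeasurableSet (ray X u) →
      ∫⁻ y, radial X φ G (join u y) = ∫⁻ y in ray X u, radial X φ G (join u y) := by
    intro hX u hm
    rw [← lintegral_indicator hm]
    refine lintegral_congr fun y => ?_
    by_cases hy : y ∈ ray X u
    · rw [indicator_of_mem hy]
    · rw [indicator_of_notMem hy, radial_join_eq_zero hX hG0 hy]
  cases X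
  · simp only [sheets, Finset.sum_singleton, one_mul]
    exact lintegral_congr fun u => hfull (by simp) u measurableSet_Ioi
  · have hne : (1 : ℝ) ∉ ({-1} : Finset ℝ) := by
      rw [Finset.mem_singleton]
      norm_num
    have hm : Measurable fun p : EuclideanSpace ℝ (Fin k) × ℝ =>
        radial .spherical φ G (join p.1 p.2) := hR.comp measurable_join
    simp only [sheets]
    rw [Finset.sum_insert hne, Finset.sum_singleton, ← lintegral_add_left]
    · refine lintegral_congr fun u => ?_
      simp only [one_mul, neg_one_mul, ray]
      -- Reflection turns the lower hemisphere into the half-line `y < 0`; the equator contributes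
      -- only `y = 0`, a null set.
      have h0 : ∫⁻ y in Ioi (0 : ℝ), radial .spherical φ G (join u (-y)) =
          ∫⁻ y in Iio (0 : ℝ), radial .spherical φ G (join u y) := by
        rw [← lintegral_indicator measurableSet_Ioi, ← lintegral_indicator measurableSet_Iio,
          ← lintegral_neg_eq_self ((Iio (0 : ℝ)).indicator _)]
        refine lintegral_congr fun y => ?_
        simp only [indicator, mem_Ioi, mem_Iio, neg_lt_zero]
      rw [h0, ← setLIntegral_congr Iio_ae_eq_Iic.symm, ← compl_Ioi]
      exact (lintegral_add_compl _ measurableSet_Ioi).symm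
    · simp only [one_mul, ray]
      exact hm.lintegral_prod_right'
  · simp only [sheets, Finset.sum_singleton, one_mul]
    exact lintegral_congr fun u => hfull (by simp) u measurableSet_Ioi


/-! ### The form and the frames of a hyperplane -/

/-- `form` as a bilinear form. -/
noncomputable def formBilin (X : Geometry) (k : ℕ) : LinearMap.BilinForm ℝ (Ambient k) :=
  LinearMap.mk₂ ℝ (form X)
    (fun a b c => by
      simp only [form, PiLp.add_apply, add_mul, Finset.sum_add_distrib]
      ring)
    (fun s a b => by
      simp only [form, PiLp.smul_apply, smul_eq_mul, mul_assoc, ← Finset.mul_sum]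
      ring)
    (fun a b c => by
      simp only [form, PiLp.add_apply, mul_add, Finset.sum_add_distrib]
      ring)
    (fun s a b => by
      simp only [form, PiLp.smul_apply, smul_eq_mul, mul_left_comm _ s, ← Finset.mul_sum]
      ring)

theorem formBilin_apply (X : Geometry) {k : ℕ} (a b : Ambient k) :
    formBilin X k a b = form X a b := rfl

theorem form_comm (X : Geometry) {k : ℕ} (a b : Ambient k) : form X a b = form X b a := by
  simp only [form, mul_comm]

theorem form_add_left (X : Geometry) {k : ℕ} (a b c : Ambient k) :
    form X (a + b) c = form X a c + form X b c := by
  simp [← formBilin_apply]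

theorem form_sub_left (X : Geometry) {k : ℕ} (a b c : Ambient k) :
    form X (a - b) c = form X a c - form X b c := by
  simp [← formBilin_apply]

theorem form_sub_right (X : Geometry) {k : ℕ} (a b c : Ambient k) :
    form X a (b - c) = form X a b - form X a c := by
  simp [← formBilin_apply]

theorem form_smul_left (X : Geometry) {k : ℕ} (s : ℝ) (a c : Ambient k) :
    form X (s • a) c = s * form X a c := by
  simp [← formBilin_apply]

theorem form_smul_right (X : Geometry) {k : ℕ} (s : ℝ) (a c : Ambient k) :
    form X a (s • c) = s * form X a c := by
  simp [← formBilin_apply]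

theorem form_sum_left (X : Geometry) {k : ℕ} {ι : Type*} (s : Finset ι) (a : ι → Ambient k)
    (c : Ambient k) : form X (∑ i ∈ s, a i) c = ∑ i ∈ s, form X (a i) c := by
  simp [← formBilin_apply, LinearMap.sum_apply]

theorem delta_sq (X : Geometry) : X.delta * X.delta = 1 := by
  cases X <;> simp [Geometry.delta]

theorem delta_ne_zero (X : Geometry) : X.delta ≠ 0 := by
  cases X <;> simp [Geometry.delta]

/-- The vector whose orthogonal complement is the tangent space at `c`. -/
noncomputable def pole (X : Geometry) {k : ℕ} (c : Ambient k) : Ambient k :=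
  match X with
  | .euclidean => join 0 1
  | .spherical => c
  | .hyperbolic => c

theorem form_join_zero (X : Geometry) {k : ℕ} (v : Ambient k) :
    form X v (join 0 1) = X.delta * v (Fin.last k) := by
  simp [form]

theorem mem_tangent_iff {X : Geometry} {k : ℕ} {c v : Ambient k} :
    v ∈ tangent X c ↔ form X v (pole X c) = 0 := by
  cases X
  · simp [tangent, pole, form_join_zero, Geometry.delta]
  · rfl
  · rfl

theorem form_pole_self {X : Geometry} {k : ℕ} {c : Ambient k} (hc : c ∈ space X k) :
    form X (pole X c) (pole X c) = X.delta := by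
  cases X
  · simp [pole, form_join_zero]
  · exact hc
  · exact hc.1

theorem form_pole_center {X : Geometry} {k : ℕ} {c : Ambient k} (hc : c ∈ space X k) :
    form X (pole X c) c = X.delta := by
  cases X
  · have h : c (Fin.last k) = 1 := hc
    rw [form_comm]
    simp [pole, form_join_zero, h]
  · exact hc
  · exact hc.1

/-- Either the tangent vectors are the vectors parallel to an affine hyperplane, or the center is
orthogonal to them. -/
theorem tangent_dichotomy {X : Geometry} {k : ℕ} {c : Ambient k} (hc : c ∈ space X k) :
    (X = .euclidean ∧ (∀ r ∈ space X k, r (Fin.last k) = 1) ∧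
      ∀ v ∈ tangent X c, v (Fin.last k) = 0) ∨
    (X ≠ .euclidean ∧ form X c c = X.delta ∧ ∀ v ∈ tangent X c, form X c v = 0) := by
  cases X
  · exact Or.inl ⟨rfl, fun r hr => hr, fun v hv => hv⟩
  · exact Or.inr ⟨by simp, hc, fun v hv => (form_comm _ _ _).trans hv⟩
  · exact Or.inr ⟨by simp, hc.1, fun v hv => (form_comm _ _ _).trans hv⟩

theorem sum_castSucc_mul_sq_le {k : ℕ} (a b : Ambient k) :
    (∑ i : Fin k, a i.castSucc * b i.castSucc) ^ 2 ≤
      (∑ i : Fin k, a i.castSucc * a i.castSucc) * ∑ i : Fin k, b i.castSucc * b i.castSucc := by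
  have h := Finset.sum_mul_sq_le_sq_mul_sq Finset.univ (fun i : Fin k => a i.castSucc)
    fun i => b i.castSucc
  simpa only [sq] using h

theorem eq_zero_of_sum_castSucc {k : ℕ} {v : Ambient k}
    (h : ∑ i : Fin k, v i.castSucc * v i.castSucc = 0) (h' : v (Fin.last k) = 0) : v = 0 := by
  refine ambient_ext (fun i => ?_) h'
  have := (Finset.sum_eq_zero_iff_of_nonneg fun i _ => mul_self_nonneg (v i.castSucc)).1 h i
    (Finset.mem_univ i)
  exact mul_self_eq_zero.1 this

theorem sum_castSucc_nonneg {k : ℕ} (v : Ambient k) :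
    0 ≤ ∑ i : Fin k, v i.castSucc * v i.castSucc :=
  Finset.sum_nonneg fun _ _ => mul_self_nonneg _

/-- The form is positive definite on the tangent spaces. -/
theorem form_self_pos {X : Geometry} {k : ℕ} {c v : Ambient k} (hc : c ∈ space X k)
    (hv : v ∈ tangent X c) (h0 : v ≠ 0) : 0 < form X v v := by
  have hS := sum_castSucc_nonneg v
  have hdef : X.delta = 1 → 0 < form X v v := by
    intro h1
    have hl := mul_self_nonneg (v (Fin.last k))
    rw [form, h1, one_mul]
    refine lt_of_le_of_ne (add_nonneg hS hl) fun h => h0 ?_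
    exact eq_zero_of_sum_castSucc (by linarith) (mul_self_eq_zero.1 (by linarith))
  cases X
  · exact hdef rfl
  · exact hdef rfl
  · have hcs := sum_castSucc_mul_sq_le v c
    have h1 : form .hyperbolic c c = -1 := hc.1
    have h2 : form .hyperbolic v c = 0 := hv
    simp only [form, Geometry.delta] at h1 h2 ⊢
    set S := ∑ i : Fin k, v i.castSucc * v i.castSucc
    set l := v (Fin.last k)
    set d := c (Fin.last k)
    have hd : 0 < d := hc.2
    -- Cauchy–Schwarz on the first `k` coordinates becomes `l² d² ≤ S (d² - 1)`, that is, `(S - l²)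
    -- d² ≥ S`.
    have e1 : ∑ i : Fin k, v i.castSucc * c i.castSucc = l * d := by linarith
    have e2 : ∑ i : Fin k, c i.castSucc * c i.castSucc = d * d - 1 := by linarith
    rw [e1, e2] at hcs
    have hSpos : 0 < S := by
      refine lt_of_le_of_ne hS fun h => h0 ?_
      have hl : (l * d) ^ 2 ≤ 0 := by rw [← h] at hcs; linarith
      have : l * d = 0 := pow_eq_zero_iff two_ne_zero |>.1 (le_antisymm hl (sq_nonneg _))
      exact eq_zero_of_sum_castSucc h.symm ((mul_eq_zero.1 this).resolve_right hd.ne')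
    have : 0 < (S - l * l) * (d * d) := by nlinarith
    have := pos_of_mul_pos_left this (mul_self_nonneg d)
    linarith

theorem form_self_nonneg {X : Geometry} {k : ℕ} {c v : Ambient k} (hc : c ∈ space X k)
    (hv : v ∈ tangent X c) : 0 ≤ form X v v := by
  by_cases h : v = 0
  · subst h
    simp [form]
  · exact (form_self_pos hc hv h).le

/-- Cauchy–Schwarz on the tangent space: the square of `v - ⟨v, w⟩ w` is `1 - ⟨v, w⟩²`. -/
theorem abs_form_le_one {X : Geometry} {k : ℕ} {c v w : Ambient k} (hc : c ∈ space X k)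
    (hv : v ∈ tangent X c) (hw : w ∈ tangent X c) (hv1 : form X v v = 1) (hw1 : form X w w = 1) :
    |form X v w| ≤ 1 := by
  have hmem : v - form X v w • w ∈ tangent X c := by
    rw [mem_tangent_iff] at *
    rw [form_sub_left, form_smul_left, hv, hw]
    simp
  have h := form_self_nonneg hc hmem
  simp only [form_sub_left, form_sub_right, form_smul_left, form_smul_right, hv1, hw1,
    form_comm X w v] at h
  exact abs_le_one_iff_mul_self_le_one.2 (by nlinarith)

/-- Every point and unit normal vector have a frame. -/
theorem exists_isHyperplaneFrame {X : Geometry} {k : ℕ} {c ν : Ambient (k + 1)}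
    (hc : c ∈ space X (k + 1)) (hν : ν ∈ tangent X c) (hν1 : form X ν ν = 1) :
    ∃ e : Fin k → Ambient (k + 1), IsHyperplaneFrame X c ν e := by
  have hνp := mem_tangent_iff.1 hν
  set B := formBilin X (k + 1) with hB
  -- The kernel is the tangent space of the hyperplane, of dimension `k` by surjectivity. The form
  -- is positive definite there, so an orthogonal basis can be normalized.
  set ℓ : Ambient (k + 1) →ₗ[ℝ] ℝ × ℝ := (B.flip (pole X c)).prod (B.flip ν) with hℓ
  have hℓa : ∀ v, ℓ v = (form X v (pole X c), form X v ν) := fun v => rfl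
  have hsurj : Function.Surjective ℓ := by
    rintro ⟨x, y⟩
    refine ⟨(X.delta * x) • pole X c + y • ν, ?_⟩
    rw [hℓa, form_add_left, form_add_left, form_smul_left, form_smul_left, form_smul_left,
      form_smul_left, form_pole_self hc, hνp, form_comm X (pole X c), hνp, hν1]
    ext
    · linear_combination x * delta_sq X
    · simp
  have hrank : Module.finrank ℝ (LinearMap.ker ℓ) = k := by
    have h := LinearMap.finrank_range_add_finrank_ker ℓ
    rw [LinearMap.range_eq_top.2 hsurj, finrank_top, Module.finrank_prod, Module.finrank_self,
      finrank_euclideanSpace, Fintype.card_fin] at h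
    omega
  have hsymm : LinearMap.IsSymm (B.restrict (LinearMap.ker ℓ)) :=
    ⟨fun x y => form_comm X (x : Ambient (k + 1)) y⟩
  obtain ⟨b, hb⟩ := LinearMap.BilinForm.exists_orthogonal_basis (V := LinearMap.ker ℓ)
    (B := B.restrict (LinearMap.ker ℓ)) hsymm
  have hmem : ∀ i, form X (b i : Ambient (k + 1)) (pole X c) = 0 ∧
      form X (b i : Ambient (k + 1)) ν = 0 := by
    intro i
    have h : ℓ (b i) = 0 := (b i).2
    rw [hℓa] at h
    exact ⟨congrArg Prod.fst h, congrArg Prod.snd h⟩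
  have hpos : ∀ i, 0 < form X (b i : Ambient (k + 1)) (b i) := fun i =>
    form_self_pos hc (mem_tangent_iff.2 (hmem i).1) fun h => b.ne_zero i (Subtype.ext h)
  have hort : ∀ i j, i ≠ j → form X (b i : Ambient (k + 1)) (b j) = 0 := fun i j hij => hb hij
  refine ⟨fun i => (Real.sqrt (form X (b (Fin.cast hrank.symm i) : Ambient (k + 1))
    (b (Fin.cast hrank.symm i))))⁻¹ • (b (Fin.cast hrank.symm i) : Ambient (k + 1)), ?_, ?_, ?_⟩
  · intro i
    rw [mem_tangent_iff, form_smul_left, (hmem _).1, mul_zero]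
  · intro i j
    rw [form_smul_left, form_smul_right]
    split_ifs with h
    · subst h
      have h1 := Real.mul_self_sqrt (hpos (Fin.cast hrank.symm i)).le
      have h2 := Real.sqrt_pos.2 (hpos (Fin.cast hrank.symm i))
      field_simp
      rw [sq, h1]
    · rw [hort _ _ fun h' => h (Fin.cast_injective _ h'), mul_zero, mul_zero]
  · intro i
    rw [form_smul_left, (hmem _).2, mul_zero]

/-- The diagonal matrix of the form. -/
noncomputable def formMatrix (X : Geometry) (k : ℕ) : Matrix (Fin (k + 1)) (Fin (k + 1)) ℝ :=
  Matrix.diagonal (Fin.snoc (α := fun _ => ℝ) (fun _ => 1) X.delta)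

theorem det_formMatrix (X : Geometry) (k : ℕ) : (formMatrix X k).det = X.delta := by
  simp [formMatrix, Fin.prod_univ_castSucc]

/-- The matrix with the given columns. -/
noncomputable def colMatrix {k : ℕ} (v : Fin (k + 1) → Ambient k) :
    Matrix (Fin (k + 1)) (Fin (k + 1)) ℝ :=
  Matrix.of fun i j => v j i

theorem transpose_mul_formMatrix_mul (X : Geometry) {k : ℕ} (v w : Fin (k + 1) → Ambient k) :
    (colMatrix v).transpose * formMatrix X k * colMatrix w =
      Matrix.of fun i j => form X (v i) (w j) := by
  ext i j
  rw [Matrix.mul_apply]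
  simp only [formMatrix, Matrix.mul_diagonal, Matrix.transpose_apply, colMatrix, Matrix.of_apply,
    Fin.sum_univ_castSucc, Fin.snoc_castSucc, Fin.snoc_last, form, mul_one]
  ring

/-- The vectors of a frame, a vector and the normal vector. -/
def frameCols {k : ℕ} (e : Fin k → Ambient (k + 1)) (o ν : Ambient (k + 1)) :
    Fin (k + 2) → Ambient (k + 1) :=
  Fin.snoc (α := fun _ => Ambient (k + 1)) (Fin.snoc (α := fun _ => Ambient (k + 1)) e o) ν

/-- The mixed Gram matrix `AᵀJB` of the two families is the identity except in the column of `d`,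
whose diagonal entry is `δ`. Its determinant is therefore `δ`, and `det J = δ` cancels. -/
theorem det_frameCols_mul {X : Geometry} {k : ℕ} {e : Fin k → Ambient (k + 1)}
    {o ν d : Ambient (k + 1)} (hee : ∀ i j, form X (e i) (e j) = if i = j then 1 else 0)
    (heν : ∀ i, form X (e i) ν = 0) (hνν : form X ν ν = 1) (hoe : ∀ i, form X o (e i) = 0)
    (hoν : form X o ν = 0) (hod : form X o d = X.delta) :
    (colMatrix (frameCols e o ν)).det * (colMatrix (frameCols e d ν)).det = 1 := by
  set T := Matrix.of fun i j => form X (frameCols e o ν i) (frameCols e d ν j) with hT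
  have hTc : T = (1 : Matrix (Fin (k + 2)) (Fin (k + 2)) ℝ).updateCol (Fin.last k).castSucc
      fun i => T i (Fin.last k).castSucc := by
    ext i j
    refine Fin.lastCases ?_ (fun j => Fin.lastCases ?_ (fun j => ?_) j) j
    · rw [Matrix.updateCol_ne (Fin.castSucc_lt_last _).ne']
      refine Fin.lastCases ?_ (fun i => Fin.lastCases ?_ (fun i => ?_) i) i
      · simp [hT, frameCols, hνν]
      · simp [hT, frameCols, hoν, Fin.ext_iff]
      · rw [Matrix.one_apply_ne (Fin.castSucc_lt_last _).ne]
        simp [hT, frameCols, heν]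
    · rw [Matrix.updateCol_self]
    · rw [Matrix.updateCol_ne (fun h => (Fin.castSucc_lt_last j).ne (Fin.castSucc_injective _ h))]
      refine Fin.lastCases ?_ (fun i => Fin.lastCases ?_ (fun i => ?_) i) i
      · rw [Matrix.one_apply_ne (Fin.castSucc_lt_last _).ne']
        simp [hT, frameCols, form_comm X ν, heν]
      · rw [Matrix.one_apply_ne fun h => (Fin.castSucc_lt_last j).ne' (Fin.castSucc_injective _ h)]
        simp [hT, frameCols, hoe]
      · simp [hT, frameCols, hee, Matrix.one_apply]
  have hdet : T.det = X.delta := by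
    rw [hTc, ← Matrix.cramer_apply, Matrix.cramer_one]
    simp [hT, frameCols, hod]
  rw [hT, ← transpose_mul_formMatrix_mul, Matrix.det_mul, Matrix.det_mul, Matrix.det_transpose,
    det_formMatrix] at hdet
  exact mul_left_cancel₀ (delta_ne_zero X) (by linear_combination hdet)

/-- In the Euclidean case `c` need not be orthogonal to the frame, so the comparison goes through
`pole X c`: taking `d` equal to the pole and then to `c` shows that the two determinants agree and
have square `1`. -/
theorem abs_det_frameCols {X : Geometry} {k : ℕ} {c ν : Ambient (k + 1)}
    {e : Fin k → Ambient (k + 1)} (hc : c ∈ space X (k + 1)) (hν : ν ∈ tangent X c)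
    (hν1 : form X ν ν = 1) (he : IsHyperplaneFrame X c ν e) :
    |(colMatrix (frameCols e c ν)).det| = 1 := by
  have hoe : ∀ i, form X (pole X c) (e i) = 0 := fun i =>
    (form_comm _ _ _).trans (mem_tangent_iff.1 (he.1 i))
  have hoν : form X (pole X c) ν = 0 := (form_comm _ _ _).trans (mem_tangent_iff.1 hν)
  have h1 := det_frameCols_mul he.2.1 he.2.2 hν1 hoe hoν (form_pole_self hc)
  have h2 := det_frameCols_mul he.2.1 he.2.2 hν1 hoe hoν (form_pole_center hc)
  have h3 : (colMatrix (frameCols e c ν)).det = (colMatrix (frameCols e (pole X c) ν)).det :=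
    mul_left_cancel₀ (left_ne_zero_of_mul_eq_one h1) (h2.trans h1.symm)
  rw [← h3] at h1
  rw [← sq_eq_sq₀ (abs_nonneg _) zero_le_one, sq_abs, sq, h1, one_pow]


/-! ### Hyperplanes as images of the space of one dimension less. -/

theorem frameMap_last {k : ℕ} (c : Ambient (k + 1)) (e : Fin k → Ambient (k + 1)) (y : Ambient k) :
    frameMap c e y (Fin.last (k + 1)) =
      ∑ i, y i.castSucc * e i (Fin.last (k + 1)) + y (Fin.last k) * c (Fin.last (k + 1)) := by
  simp [frameMap]

theorem form_frameMap_left (X : Geometry) {k : ℕ} (c : Ambient (k + 1))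
    (e : Fin k → Ambient (k + 1)) (y : Ambient k) (w : Ambient (k + 1)) :
    form X (frameMap c e y) w =
      ∑ i, y i.castSucc * form X (e i) w + y (Fin.last k) * form X c w := by
  rw [frameMap, form_add_left, form_sum_left, form_smul_left]
  simp only [form_smul_left]

/-- In the curved cases `c` is orthogonal to the frame with `⟨c, c⟩ = δ`. In the Euclidean case this
can fail, and only vectors with last coordinate `0` are treated, which suffices for differentials of
the chart. -/
theorem form_frameMap {X : Geometry} {k : ℕ} {c ν : Ambient (k + 1)}
    {e : Fin k → Ambient (k + 1)} (hc : c ∈ space X (k + 1)) (he : IsHyperplaneFrame X c ν e)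
    {y z : Ambient k} (hy : X = .euclidean → y (Fin.last k) = 0)
    (hz : X = .euclidean → z (Fin.last k) = 0) :
    form X (frameMap c e y) (frameMap c e z) = form X y z := by
  have h1 : ∀ i, form X (e i) (frameMap c e z) =
      z i.castSucc + z (Fin.last k) * form X c (e i) := by
    intro i
    rw [form_comm, form_frameMap_left]
    simp only [he.2.1, mul_ite, mul_one, mul_zero, Finset.sum_ite_eq', Finset.mem_univ, if_true]
  have h2 : form X c (frameMap c e z) =
      ∑ i, z i.castSucc * form X c (e i) + z (Fin.last k) * form X c c := by
    rw [form_comm, form_frameMap_left]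
    simp only [form_comm X c]
  rw [form_frameMap_left, h2]
  simp only [h1]
  rcases tangent_dichotomy hc with ⟨hX, -, -⟩ | ⟨-, hcc, hct⟩
  · simp [hy hX, hz hX, form]
  · simp only [hct _ (he.1 _), hcc, mul_zero, add_zero, Finset.sum_const_zero, zero_add]
    rw [form]
    ring

theorem materialMass_frameMap {X : Geometry} {k : ℕ} {c ν : Ambient (k + 1)}
    {e : Fin k → Ambient (k + 1)} (hc : c ∈ space X (k + 1)) (he : IsHyperplaneFrame X c ν e)
    (y : Ambient k) : materialMass X (frameMap c e y) = materialMass X y := by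
  cases X
  · have h : ∀ i, e i (Fin.last (k + 1)) = 0 := he.1
    have h' : c (Fin.last (k + 1)) = 1 := hc
    simp [materialMass, frameMap_last, h, h']
  · simp only [materialMass]
    rw [form_frameMap hc he (fun h => by cases h) (fun h => by cases h)]
  · simp only [materialMass]
    rw [form_frameMap hc he (fun h => by cases h) (fun h => by cases h)]

/-- The reversed Cauchy–Schwarz inequality for the upper sheet. It decides the sheet of `y` from
that of `frameMap c e y`, because `⟨frameMap c e y, c⟩` is minus the last coordinate of `y`. -/
theorem hyperbolic_form_neg {k : ℕ} {r c : Ambient k} (hr : r ∈ space .hyperbolic k)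
    (hc : c ∈ space .hyperbolic k) : form .hyperbolic r c < 0 := by
  have hcs := sum_castSucc_mul_sq_le r c
  have h1 : form .hyperbolic r r = -1 := hr.1
  have h2 : form .hyperbolic c c = -1 := hc.1
  have hr0 := hr.2
  have hc0 := hc.2
  simp only [form, Geometry.delta] at h1 h2 ⊢
  have h3 : (∑ i : Fin k, r i.castSucc * c i.castSucc) ^ 2 <
      (r (Fin.last k) * c (Fin.last k)) ^ 2 := by
    refine hcs.trans_lt ?_
    rw [show ∑ i : Fin k, r i.castSucc * r i.castSucc = r (Fin.last k) ^ 2 - 1 by linarith,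
      show ∑ i : Fin k, c i.castSucc * c i.castSucc = c (Fin.last k) ^ 2 - 1 by linarith]
    have := sum_castSucc_nonneg c
    nlinarith [pow_pos hr0 2, pow_pos hc0 2]
  have := (abs_lt.1 (abs_lt_of_sq_lt_sq h3 (mul_pos hr0 hc0).le)).2
  linarith

theorem mem_space_of_frameMap {X : Geometry} {k : ℕ} {c ν : Ambient (k + 1)}
    {e : Fin k → Ambient (k + 1)} (hc : c ∈ space X (k + 1)) (he : IsHyperplaneFrame X c ν e)
    {y : Ambient k} (hy : frameMap c e y ∈ space X (k + 1)) : y ∈ space X k := by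
  cases X
  · have h : ∀ i, e i (Fin.last (k + 1)) = 0 := he.1
    have h' : c (Fin.last (k + 1)) = 1 := hc
    have hy' : frameMap c e y (Fin.last (k + 1)) = 1 := hy
    rw [frameMap_last] at hy'
    simp only [h, h', mul_zero, Finset.sum_const_zero, zero_add, mul_one] at hy'
    exact hy'
  · have hy' : form .spherical (frameMap c e y) (frameMap c e y) = 1 := hy
    rwa [form_frameMap hc he (fun h => by cases h) (fun h => by cases h)] at hy'
  · have hy' := hy.1
    rw [form_frameMap hc he (fun h => by cases h) (fun h => by cases h)] at hy'
    refine ⟨hy', ?_⟩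
    have hn := hyperbolic_form_neg hy hc
    have h : ∀ i, form .hyperbolic (e i) c = 0 := he.1
    have h' : form .hyperbolic c c = -1 := hc.1
    rw [form_frameMap_left] at hn
    simp only [h, h', mul_zero, Finset.sum_const_zero, zero_add] at hn
    linarith

/-- The coefficients of the linear form `x ↦ ⟨x, ν⟩ - β x_{k+1}`. With `β = ⟨c, ν⟩` it vanishes on
the hyperplane through `c` with normal vector `ν`. -/
noncomputable def normalCovector (X : Geometry) {k : ℕ} (ν : Ambient k) (β : ℝ) : Fin (k + 1) → ℝ :=
  Fin.snoc (α := fun _ => ℝ) (fun i => ν i.castSucc) (X.delta * ν (Fin.last k) - β)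

theorem normalCovector_dotProduct (X : Geometry) {k : ℕ} (ν : Ambient k) (β : ℝ)
    (x : Fin (k + 1) → ℝ) : normalCovector X ν β ⬝ᵥ x =
      form X (WithLp.toLp 2 x) ν - β * x (Fin.last k) := by
  simp only [dotProduct, normalCovector, Fin.sum_univ_castSucc, Fin.snoc_castSucc, Fin.snoc_last,
    form, mul_comm (ν _)]
  ring

/-- `frameMap` as a linear map. -/
noncomputable def frameLin {k : ℕ} (c : Ambient (k + 1)) (e : Fin k → Ambient (k + 1)) :
    (Fin (k + 1) → ℝ) →ₗ[ℝ] (Fin (k + 2) → ℝ) where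
  toFun y := (frameMap c e (WithLp.toLp 2 y)).ofLp
  map_add' y z := by
    ext j
    simp only [frameMap, PiLp.add_apply, Pi.add_apply, add_smul, Finset.sum_add_distrib,
      WithLp.ofLp_add]
    ring
  map_smul' s y := by
    ext j
    simp [frameMap, mul_smul]
    rw [mul_add, Finset.mul_sum]

theorem toLp_frameLin {k : ℕ} (c : Ambient (k + 1)) (e : Fin k → Ambient (k + 1))
    (y : Fin (k + 1) → ℝ) :
    WithLp.toLp 2 (frameLin c e y) = frameMap c e (WithLp.toLp 2 y) := rfl

theorem frameMap_smul {k : ℕ} (c : Ambient (k + 1)) (e : Fin k → Ambient (k + 1)) (s : ℝ)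
    (y : Ambient k) : frameMap c e (s • y) = s • frameMap c e y := by
  have h := (frameLin c e).map_smul s y.ofLp
  exact congrArg (WithLp.toLp 2) h

theorem continuous_frameMap {k : ℕ} (c : Ambient (k + 1)) (e : Fin k → Ambient (k + 1)) :
    Continuous (frameMap c e) := by
  unfold frameMap
  fun_prop

theorem colMatrix_frameCols_mulVec {k : ℕ} (e : Fin k → Ambient (k + 1)) (c ν : Ambient (k + 1))
    (y : Fin (k + 1) → ℝ) (τ : ℝ) :
    (colMatrix (frameCols e c ν)).mulVec
      ((Fin.last (k + 1)).insertNth (α := fun _ => ℝ) τ y) = frameLin c e y + τ • ν.ofLp := by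
  ext j
  simp only [Matrix.mulVec, dotProduct, colMatrix, Matrix.of_apply, Fin.insertNth_last',
    Fin.sum_univ_castSucc, Fin.snoc_castSucc, Fin.snoc_last, frameCols, frameLin, frameMap]
  simp [mul_comm]

/-- The vectors of the frame, `c` and `ν` form a unimodular system with `a ⬝ᵥ ν = 1`, so by
`lintegral_comp_eq_leray` the measure is Lebesgue measure in the coordinates of `frameMap`. These
coordinates preserve the material mass, and `lintegral_radial` applies to the space of one dimension
less. -/
theorem leray_radial {X : Geometry} {k : ℕ} {c ν : Ambient (k + 1)} (hc : c ∈ space X (k + 1))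
    (hν : ν ∈ tangent X c) (hν1 : form X ν ν = 1) {φ : ℝ → ENNReal} (hφ : Measurable φ)
    {G : Ambient (k + 1) → ENNReal} (hG : Measurable G) (hG0 : ∀ r, r ∉ space X (k + 1) → G r = 0) :
    leray (normalCovector X ν (form X c ν)) (fun x => radial X φ G (WithLp.toLp 2 x)) =
      (∫⁻ s in Ioi (0 : ℝ), ENNReal.ofReal (s ^ k) * φ s) *
        ∫⁻ r, G r ∂(hyperplaneVolume X c ν) := by
  have hex := exists_isHyperplaneFrame hc hν hν1
  set e := hex.choose with he_def
  have he : IsHyperplaneFrame X c ν e := hex.choose_spec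
  have hdet := abs_det_frameCols hc hν hν1 he
  have hFc := continuous_frameMap c e
  set a := normalCovector X ν (form X c ν) with ha
  have haF : ∀ y, a ⬝ᵥ frameLin c e y = 0 := by
    intro y
    have hlast : (frameLin c e y) (Fin.last (k + 1)) =
      frameMap c e (WithLp.toLp 2 y) (Fin.last (k + 1)) := rfl
    rw [ha, normalCovector_dotProduct, toLp_frameLin, form_frameMap_left, hlast, frameMap_last]
    simp only [he.2.2, mul_zero, Finset.sum_const_zero, zero_add]
    rcases tangent_dichotomy hc with ⟨-, hX, ht⟩ | ⟨-, -, ht⟩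
    · simp only [ht _ (he.1 _), hX c hc]
      simp
      ring
    · simp [ht ν hν]
  have haν : a ⬝ᵥ ν.ofLp = 1 := by
    rw [ha, normalCovector_dotProduct]
    rcases tangent_dichotomy hc with ⟨-, hX, ht⟩ | ⟨-, -, ht⟩
    · rw [ht ν hν]
      simp [hν1]
    · rw [ht ν hν]
      simp [hν1]
  have hker : ∀ x, a ⬝ᵥ x = 0 → ∃ y, frameLin c e y = x := by
    intro x hx
    have hu : IsUnit (colMatrix (frameCols e c ν)).det := by
      refine isUnit_iff_ne_zero.2 fun h => ?_
      simp [h] at hdet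
    obtain ⟨z, rfl⟩ : ∃ z, (colMatrix (frameCols e c ν)).mulVec z = x :=
      ⟨(colMatrix (frameCols e c ν))⁻¹.mulVec x, by
        rw [Matrix.mulVec_mulVec, Matrix.mul_nonsing_inv _ hu, Matrix.one_mulVec]⟩
    rw [← Fin.insertNth_self_removeNth (Fin.last (k + 1)) z, colMatrix_frameCols_mulVec] at hx ⊢
    rw [dotProduct_add, haF, dotProduct_smul, haν, zero_add, smul_eq_mul, mul_one] at hx
    exact ⟨_, by rw [hx, zero_smul, add_zero]⟩
  have hR : Measurable fun x : Fin (k + 2) → ℝ => radial X φ G (WithLp.toLp 2 x) :=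
    (measurable_radial X hφ hG).comp (MeasurableEquiv.toLp 2 (Fin (k + 2) → ℝ)).measurable
  rw [← lintegral_comp_eq_leray haF haν hker (fun f hf => by
    rw [← lintegral_comp_mulVec hdet hf, lintegral_pi_insertNth (Fin.last (k + 1))]
    · simp only [colMatrix_frameCols_mulVec]
    · exact hf.comp (Matrix.mulVecLin (colMatrix (frameCols e c ν))).continuous_of_finiteDimensional.measurable) hR]
  have hrad : ∀ y : Ambient k, radial X φ G (frameMap c e y) =
      radial X φ (fun z => G (frameMap c e z)) y := by
    intro y
    rw [radial, radial, materialMass_frameMap hc he, frameMap_smul]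
  simp only [toLp_frameLin, hrad]
  rw [← lintegral_euclidean (radial X φ fun z => G (frameMap c e z)),
    lintegral_radial X hφ (show Measurable fun z => G (frameMap c e z) from
      hG.comp hFc.measurable)
      fun r hr => hG0 _ fun h => hr (mem_space_of_frameMap hc he h)]
  congr 1
  rw [hyperplaneVolume, dif_pos hex, lintegral_finsetSum_measure,
    lintegral_spaceVolume X (show Measurable fun z => G (frameMap c e z) from
      hG.comp hFc.measurable)]
  refine Finset.sum_congr rfl fun σ hσ => ?_
  refine (lintegral_patchVolume X (hFc.measurable.comp (measurable_graphParam X k σ))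
    (measurableSet_chartDomain X k) (continuous_height X).measurable.inv.ennreal_ofReal
    (fun s hs => ?_) hG).symm
  -- `frameMap` is linear and isometric on the differentials of the chart; Euclidean ones have last
  -- coordinate `0` because the height is constant.
  have hgram : gram X (frameMap c e ∘ graphParam X k σ) s = gram X (graphParam X k σ) s := by
    set A : Ambient k →L[ℝ] Ambient (k + 1) := LinearMap.toContinuousLinearMap
      ((WithLp.linearEquiv 2 ℝ (Fin (k + 2) → ℝ)).symm.toLinearMap ∘ₗ frameLin c e ∘ₗ
        (WithLp.linearEquiv 2 ℝ (Fin (k + 1) → ℝ)).toLinearMap)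
    have hL : HasFDerivAt (frameMap c e) A (graphParam X k σ s) := A.hasFDerivAt
    have hd := hL.comp s (hasFDerivAt_graphParam σ hs)
    have hdv : ∀ v, fderiv ℝ (frameMap c e ∘ graphParam X k σ) s v =
        frameMap c e (fderiv ℝ (graphParam X k σ) s v) := by
      intro v
      rw [hd.fderiv, (hasFDerivAt_graphParam σ hs).fderiv]
      rfl
    ext i j
    simp only [gram, Matrix.of_apply, hdv]
    refine form_frameMap hc he ?_ ?_ <;>
    · rintro rfl
      rw [fderiv_graphParam σ hs]
      simp [heightDeriv]
  rw [hgram, sqrt_det_gram_graphParam hσ hs]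
  rfl

theorem hasDerivWithinAt_form (X : Geometry) {k : ℕ} {f g : ℝ → Ambient k} {f' g' : Ambient k}
    {s : Set ℝ} {t : ℝ} (hf : HasDerivWithinAt f f' s t) (hg : HasDerivWithinAt g g' s t) :
    HasDerivWithinAt (fun t => form X (f t) (g t)) (form X f' (g t) + form X (f t) g') s t := by
  have hf' : ∀ i, HasDerivWithinAt (fun t => f t i) (f' i) s t := fun i =>
    (EuclideanSpace.proj (𝕜 := ℝ) i).hasFDerivAt.comp_hasDerivWithinAt t hf
  have hg' : ∀ i, HasDerivWithinAt (fun t => g t i) (g' i) s t := fun i =>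
    (EuclideanSpace.proj (𝕜 := ℝ) i).hasFDerivAt.comp_hasDerivWithinAt t hg
  refine ((HasDerivWithinAt.fun_sum (u := Finset.univ) fun i _ =>
    (hf' (Fin.castSucc i)).mul (hg' (Fin.castSucc i))).add
    (((hf' (Fin.last k)).mul (hg' (Fin.last k))).const_mul X.delta)).congr_deriv ?_
  simp only [form, Finset.sum_add_distrib]
  ring


/-! ### The normal velocity of the sections -/

theorem measurable_indicator_of_continuousOn {E : Type*} [TopologicalSpace E] [MeasurableSpace E]
    [BorelSpace E] [Zero E] {f : ℝ → E} {I : Set ℝ} (hf : ContinuousOn f I) (hI : MeasurableSet I) :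
    Measurable (I.indicator f) := by
  classical
  rw [← piecewise_eq_indicator]
  exact hf.measurable_piecewise continuousOn_const hI

/-- `derivWithin` is `0` by default where the derivative is not unique, so unit speed already rules
out an interval reduced to a point. -/
theorem uniqueDiffOn_of_derivWithin_ne_zero {E : Type*} [NormedAddCommGroup E] [NormedSpace ℝ E]
    {I : Set ℝ} {c : ℝ → E} (hc : ∀ t ∈ I, derivWithin c I t ≠ 0) :
    UniqueDiffOn ℝ I := by
  intro t ht
  by_contra h
  exact hc t ht (derivWithin_zero_of_not_uniqueDiffWithinAt h)

namespace IsPappusSolid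

variable {X : Geometry} {n : ℕ} {P : Set (Ambient (n + 1))} {ρ : Ambient (n + 1) → ℝ} {I : Set ℝ}
  {c ν : ℝ → Ambient (n + 1)} {L : ℝ → Set (Ambient (n + 1))}

theorem uniqueDiffOn (hP : IsPappusSolid X P ρ I c ν L) : UniqueDiffOn ℝ I :=
  uniqueDiffOn_of_derivWithin_ne_zero fun t ht h => by
    have h1 := hP.curve_unitSpeed t ht
    rw [h] at h1
    simp [form] at h1

theorem measurableSet_interval (hP : IsPappusSolid X P ρ I c ν L) : MeasurableSet I :=
  hP.interval.measurableSet

theorem hasDerivWithinAt_curve (hP : IsPappusSolid X P ρ I c ν L) {t : ℝ} (ht : t ∈ I) :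
    HasDerivWithinAt c (derivWithin c I t) I t :=
  (hP.curve_contDiffOn.differentiableOn one_ne_zero t ht).hasDerivWithinAt

theorem hasDerivWithinAt_normal (hP : IsPappusSolid X P ρ I c ν L) {t : ℝ} (ht : t ∈ I) :
    HasDerivWithinAt ν (derivWithin ν I t) I t :=
  (hP.normal_contDiffOn.differentiableOn one_ne_zero t ht).hasDerivWithinAt

theorem continuousOn_derivWithin_curve (hP : IsPappusSolid X P ρ I c ν L) :
    ContinuousOn (derivWithin c I) I :=
  hP.curve_contDiffOn.continuousOn_derivWithin hP.uniqueDiffOn le_rfl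

theorem continuousOn_derivWithin_normal (hP : IsPappusSolid X P ρ I c ν L) :
    ContinuousOn (derivWithin ν I) I :=
  hP.normal_contDiffOn.continuousOn_derivWithin hP.uniqueDiffOn le_rfl

theorem derivWithin_curve_mem_tangent (hP : IsPappusSolid X P ρ I c ν L) {t : ℝ} (ht : t ∈ I) :
    derivWithin c I t ∈ tangent X (c t) := by
  have hd := hP.hasDerivWithinAt_curve ht
  have hu := hP.uniqueDiffOn t ht
  have hform : (∀ s ∈ I, form X (c s) (c s) = X.delta) → form X (derivWithin c I t) (c t) = 0 := by
    intro h
    have h1 := hasDerivWithinAt_form X hd hd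
    have h2 := hu.eq_deriv _ h1 ((hasDerivWithinAt_const t I X.delta).congr h (h t ht))
    rw [form_comm X (c t)] at h2
    linarith
  have hmem := hP.curve_mem
  cases X
  · have h1 : HasDerivWithinAt (fun t => c t (Fin.last (n + 1)))
        (derivWithin c I t (Fin.last (n + 1))) I t :=
      (EuclideanSpace.proj (𝕜 := ℝ) (Fin.last (n + 1))).hasFDerivAt.comp_hasDerivWithinAt t hd
    exact hu.eq_deriv _ h1 ((hasDerivWithinAt_const t I (1 : ℝ)).congr hmem (hmem t ht))
  · exact hform hmem
  · exact hform fun s hs => (hmem s hs).1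

/-- The derivative of `s ↦ ⟨r - c s, ν s⟩` at time `t`. -/
noncomputable def velocity (X : Geometry) {n : ℕ} (I : Set ℝ) (c ν : ℝ → Ambient (n + 1)) (t : ℝ)
    (r : Ambient (n + 1)) : ℝ :=
  form X (r - c t) (derivWithin ν I t) - form X (derivWithin c I t) (ν t)

theorem hasDerivWithinAt_form_sub (hP : IsPappusSolid X P ρ I c ν L) {t : ℝ} (ht : t ∈ I)
    (r : Ambient (n + 1)) :
    HasDerivWithinAt (fun s => form X (r - c s) (ν s)) (velocity X I c ν t r) I t := by
  refine (hasDerivWithinAt_form X ((hP.hasDerivWithinAt_curve ht).const_sub r)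
    (hP.hasDerivWithinAt_normal ht)).congr_deriv ?_
  rw [velocity, ← neg_one_smul ℝ (derivWithin c I t), form_smul_left]
  ring

/-- The derivative of the coefficients of the moving hyperplane. -/
noncomputable def covectorDeriv (X : Geometry) {n : ℕ} (I : Set ℝ) (c ν : ℝ → Ambient (n + 1))
    (t : ℝ) : Fin (n + 2) → ℝ :=
  normalCovector X (derivWithin ν I t)
    (form X (derivWithin c I t) (ν t) + form X (c t) (derivWithin ν I t))

theorem hasDerivWithinAt_covector (hP : IsPappusSolid X P ρ I c ν L) {t : ℝ} (ht : t ∈ I) :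
    HasDerivWithinAt (fun t => normalCovector X (ν t) (form X (c t) (ν t)))
      (covectorDeriv X I c ν t) I t := by
  have hν := hP.hasDerivWithinAt_normal ht
  have hνi : ∀ i, HasDerivWithinAt (fun t => ν t i) (derivWithin ν I t i) I t := fun i =>
    (EuclideanSpace.proj (𝕜 := ℝ) i).hasFDerivAt.comp_hasDerivWithinAt t hν
  refine hasDerivWithinAt_pi.2 fun i => Fin.lastCases ?_ (fun i => ?_) i
  · simp only [normalCovector, covectorDeriv, Fin.snoc_last]
    exact ((hνi _).const_mul _).sub (hasDerivWithinAt_form X (hP.hasDerivWithinAt_curve ht) hν)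
  · simp only [normalCovector, covectorDeriv, Fin.snoc_castSucc]
    exact hνi _

theorem continuousOn_form (X : Geometry) {k : ℕ} {Z : Type*} [TopologicalSpace Z]
    {s : Set Z} {a b : Z → Ambient k} (ha : ContinuousOn a s) (hb : ContinuousOn b s) :
    ContinuousOn (fun z => form X (a z) (b z)) s := by
  unfold form
  fun_prop

theorem continuousOn_covectorDeriv (hP : IsPappusSolid X P ρ I c ν L) :
    ContinuousOn (covectorDeriv X I c ν) I := by
  have hν' := hP.continuousOn_derivWithin_normal
  have hc' := hP.continuousOn_derivWithin_curve
  have hν := hP.normal_contDiffOn.continuousOn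
  have hc := hP.curve_contDiffOn.continuousOn
  refine continuousOn_pi.2 fun i => Fin.lastCases ?_ (fun i => ?_) i
  · simp only [normalCovector, covectorDeriv, Fin.snoc_last]
    have h1 := (continuousOn_form X hc' hν).add (continuousOn_form X hc hν')
    refine ContinuousOn.sub ?_ h1
    fun_prop
  · simp only [normalCovector, covectorDeriv, Fin.snoc_castSucc]
    fun_prop

/-- Replaces the affine velocity by a linear form in `r`, which can be exchanged with the vector
integral. For Euclidean points the last coordinate is `1`; in the curved cases `⟨c, ν⟩` is
identically `0`, so `⟨c', ν⟩ + ⟨c, ν'⟩ = 0`. -/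
theorem covectorDeriv_dotProduct (hP : IsPappusSolid X P ρ I c ν L) {t : ℝ} (ht : t ∈ I)
    {r : Ambient (n + 1)} (hr : r ∈ space X (n + 1)) :
    covectorDeriv X I c ν t ⬝ᵥ r.ofLp = velocity X I c ν t r := by
  rw [covectorDeriv, normalCovector_dotProduct, velocity, form_sub_left, WithLp.toLp_ofLp]
  rcases tangent_dichotomy (hP.curve_mem t ht) with ⟨-, h, -⟩ | ⟨hX, -, -⟩
  · rw [h r hr]
    ring
  · have h0 : ∀ s ∈ I, form X (c s) (ν s) = 0 := by
      intro s hs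
      rcases tangent_dichotomy (hP.curve_mem s hs) with ⟨h, -, -⟩ | ⟨-, -, h⟩
      · exact absurd h hX
      · exact h _ (hP.normal_tangent s hs)
    have h1 := (hP.uniqueDiffOn t ht).eq_deriv _
      (hasDerivWithinAt_form X (hP.hasDerivWithinAt_curve ht) (hP.hasDerivWithinAt_normal ht))
      ((hasDerivWithinAt_const t I (0 : ℝ)).congr h0 (h0 t ht))
    rw [h1]
    linarith

theorem velocity_curve (X : Geometry) {n : ℕ} (I : Set ℝ) (c ν : ℝ → Ambient (n + 1)) (t : ℝ) :
    velocity X I c ν t (c t) = -form X (derivWithin c I t) (ν t) := by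
  simp [velocity, form]

/-- The normal velocity has a constant sign on the solid. -/
theorem velocity_sign (hP : IsPappusSolid X P ρ I c ν L) :
    (∀ q ∈ parameterSet I L, 0 < velocity X I c ν q.1 q.2) ∨
      ∀ q ∈ parameterSet I L, velocity X I c ν q.1 q.2 < 0 := by
  obtain ⟨Ω, hΩ, hsub, hreg⟩ := hP.regular
  have hne : ∀ q ∈ Ω, velocity X I c ν q.1 q.2 ≠ 0 := by
    intro q hq
    obtain ⟨hI, -, h⟩ := hreg q hq
    rwa [(hP.hasDerivWithinAt_form_sub hI q.2).derivWithin (hP.uniqueDiffOn _ hI)] at h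
  have hmaps : MapsTo Prod.fst Ω I := fun q hq => (hreg q hq).1
  have hcont : ContinuousOn (fun q : ℝ × Ambient (n + 1) => velocity X I c ν q.1 q.2) Ω := by
    have hf := continuousOn_fst (s := Ω)
    have h1 := hP.curve_contDiffOn.continuousOn.comp hf hmaps
    have h2 := hP.normal_contDiffOn.continuousOn.comp hf hmaps
    have h3 := hP.continuousOn_derivWithin_curve.comp hf hmaps
    have h4 := hP.continuousOn_derivWithin_normal.comp hf hmaps
    exact (continuousOn_form X (continuousOn_snd.sub h1) h4).sub (continuousOn_form X h3 h2)
  by_contra! h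
  obtain ⟨⟨p, hp, hp'⟩, q, hq, hq'⟩ := h
  obtain ⟨z, hz, hz'⟩ := hΩ.intermediate_value (hsub hp) (hsub hq) hcont ⟨hp', hq'⟩
  exact hne z hz hz'

/-! ### Measurability, integrability and centered mass of the sections. -/

theorem section_subset_solid (hP : IsPappusSolid X P ρ I c ν L) {t : ℝ} (ht : t ∈ I) :
    L t ⊆ P := by
  rw [hP.solid_eq]
  exact subset_biUnion_of_mem (u := L) ht

theorem section_subset_space (hP : IsPappusSolid X P ρ I c ν L) {t : ℝ} (ht : t ∈ I) :
    L t ⊆ space X (n + 1) :=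
  fun _ hr => (hP.section_subset t ht hr).1

theorem measurableSet_section (hP : IsPappusSolid X P ρ I c ν L) {t : ℝ} (ht : t ∈ I) :
    MeasurableSet (L t) := by
  have h : L t = Prod.mk t ⁻¹' parameterSet I L := by
    ext r
    exact ⟨fun hr => ⟨ht, hr⟩, fun hr => hr.2⟩
  rw [h]
  exact measurable_prodMk_left hP.measurableSet_parameterSet

theorem injOn_snd_parameterSet (hP : IsPappusSolid X P ρ I c ν L) :
    InjOn Prod.snd (parameterSet I L) := by
  rintro ⟨t, r⟩ ⟨ht, hr⟩ ⟨t', r'⟩ ⟨ht', hr'⟩ h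
  dsimp only at h hr hr' ht ht'
  subst h
  by_contra hne
  refine disjoint_left.1 (hP.section_disjoint ht ht' fun h => hne ?_) hr hr'
  rw [h]

theorem solid_eq_image (hP : IsPappusSolid X P ρ I c ν L) : P = Prod.snd '' parameterSet I L := by
  rw [hP.solid_eq]
  ext r
  simp [parameterSet]

theorem measurableSet_solid (hP : IsPappusSolid X P ρ I c ν L) : MeasurableSet P := by
  rw [hP.solid_eq_image]
  exact hP.measurableSet_parameterSet.image_of_measurable_injOn measurable_snd
    hP.injOn_snd_parameterSet

theorem solid_subset_space (hP : IsPappusSolid X P ρ I c ν L) : P ⊆ space X (n + 1) := by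
  rw [hP.solid_eq]
  exact iUnion₂_subset fun t ht => hP.section_subset_space ht

/-- Boundedness of the solid makes the first moment of a finite mass integrable, so the mass center
vector is a genuine integral and not the default `0`. -/
theorem integrableOn_smul (hP : IsPappusSolid X P ρ I c ν L) {t : ℝ} (ht : t ∈ I) :
    IntegrableOn (fun r => ρ r • r) (L t) (hyperplaneVolume X (c t) (ν t)) := by
  obtain ⟨C, hC⟩ := hP.solid_bounded.exists_norm_le
  refine ((hP.section_finite t ht).norm.mul_const C).mono'
    (hP.density_measurable.smul measurable_id).aestronglyMeasurable ?_
  refine (ae_restrict_iff' (hP.measurableSet_section ht)).2 (Filter.Eventually.of_forall fun r hr => ?_)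
  rw [norm_smul]
  exact mul_le_mul_of_nonneg_left (hC r (hP.section_subset_solid ht hr)) (norm_nonneg _)

theorem centeredMass_nonneg (hP : IsPappusSolid X P ρ I c ν L) {t : ℝ} (ht : t ∈ I) :
    0 ≤ centeredMass X (c t) (ν t) (L t) ρ := by
  have hint := hP.integrableOn_smul ht
  have hsp := hP.section_subset_space ht
  have hm := hP.measurableSet_section ht
  have hρ : ∀ r ∈ L t, 0 ≤ ρ r := fun r hr => hP.density_nonneg r (hP.section_subset_solid ht hr)
  unfold centeredMass massCenterVector
  cases X
  · have h := (EuclideanSpace.proj (𝕜 := ℝ) (Fin.last (n + 1))).integral_comp_comm hint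
    simp only [materialMass]
    refine le_of_le_of_eq (setIntegral_nonneg hm fun r hr => ?_) h
    have h1 : r (Fin.last (n + 1)) = 1 := hsp hr
    have h2 := hρ r hr
    simpa [h1] using h2
  · exact Real.sqrt_nonneg _
  · exact Real.sqrt_nonneg _

theorem cos_slantAngle (hP : IsPappusSolid X P ρ I c ν L) {t : ℝ} (ht : t ∈ I) :
    Real.cos (slantAngle X (derivWithin c I t) (ν t)) = |form X (derivWithin c I t) (ν t)| := by
  have h1 := hP.curve_unitSpeed t ht
  have h2 := hP.normal_unit t ht
  have h := abs_form_le_one (hP.curve_mem t ht) (hP.derivWithin_curve_mem_tangent ht)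
    (hP.normal_tangent t ht) h1 h2
  rw [slantAngle, h1, h2, mul_one, Real.sqrt_one, div_one,
    Real.cos_arccos (by linarith [abs_nonneg (form X (derivWithin c I t) (ν t))]) h]

/-- The first moment of a section, weighted with the normal velocity. -/
theorem lintegral_section (hP : IsPappusSolid X P ρ I c ν L) {t : ℝ} (ht : t ∈ I) :
    ∫⁻ r in L t, ENNReal.ofReal (ρ r) * ENNReal.ofReal |covectorDeriv X I c ν t ⬝ᵥ r.ofLp|
        ∂(hyperplaneVolume X (c t) (ν t)) =
      ENNReal.ofReal (centeredMass X (c t) (ν t) (L t) ρ *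
        Real.cos (slantAngle X (derivWithin c I t) (ν t))) := by
  set H := hyperplaneVolume X (c t) (ν t)
  set m := centeredMass X (c t) (ν t) (L t) ρ with hm
  have hLm := hP.measurableSet_section ht
  have hρ : ∀ r ∈ L t, 0 ≤ ρ r := fun r hr => hP.density_nonneg r (hP.section_subset_solid ht hr)
  set D : Ambient (n + 1) →L[ℝ] ℝ := LinearMap.toContinuousLinearMap
    { toFun := fun r => covectorDeriv X I c ν t ⬝ᵥ r.ofLp
      map_add' := fun r s => by rw [WithLp.ofLp_add, dotProduct_add]
      map_smul' := fun a r => by rw [WithLp.ofLp_smul, dotProduct_smul]; rfl } with hD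
  have hDa : ∀ r, D r = covectorDeriv X I c ν t ⬝ᵥ r.ofLp := fun r => rfl
  have hint := hP.integrableOn_smul ht
  have hintD : IntegrableOn (fun r => ρ r * D r) (L t) H := by
    have h := D.integrable_comp hint
    simp only [map_smul, smul_eq_mul] at h
    exact h
  -- The linear form `D` goes through the integral, which is `m • c t`, and `D (c t)` is the
  -- velocity at the center.
  have hval : ∫ r in L t, ρ r * D r ∂H = -(m * form X (derivWithin c I t) (ν t)) := by
    have h := D.integral_comp_comm hint
    simp only [map_smul, smul_eq_mul] at h
    rw [h]
    have hmc := hP.massCenter t ht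
    rw [massCenterVector] at hmc
    rw [hmc, map_smul, hDa, hP.covectorDeriv_dotProduct ht (hP.curve_mem t ht), velocity_curve,
      smul_eq_mul]
    ring
  -- The constant sign of the velocity on the solid is what lets the absolute value leave the
  -- integral.
  have habs : ∫ r in L t, |ρ r * D r| ∂H = |∫ r in L t, ρ r * D r ∂H| := by
    have hDv : ∀ r ∈ L t, D r = velocity X I c ν t r := fun r hr =>
      hP.covectorDeriv_dotProduct ht (hP.section_subset_space ht hr)
    rcases hP.velocity_sign with h | h
    · have hnn : ∀ r ∈ L t, 0 ≤ ρ r * D r := fun r hr =>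
        mul_nonneg (hρ r hr) ((h (t, r) ⟨ht, hr⟩).le.trans_eq (hDv r hr).symm)
      rw [abs_of_nonneg (setIntegral_nonneg hLm hnn)]
      exact setIntegral_congr_fun hLm fun r hr => abs_of_nonneg (hnn r hr)
    · have hnp : ∀ r ∈ L t, ρ r * D r ≤ 0 := fun r hr =>
        mul_nonpos_of_nonneg_of_nonpos (hρ r hr) ((hDv r hr).trans_le (h (t, r) ⟨ht, hr⟩).le)
      rw [abs_of_nonpos (setIntegral_nonpos hLm hnp), ← integral_neg]
      exact setIntegral_congr_fun hLm fun r hr => abs_of_nonpos (hnp r hr)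
  have hm0 : 0 ≤ m := hP.centeredMass_nonneg ht
  rw [hP.cos_slantAngle ht, ← abs_of_nonneg hm0, ← abs_mul, ← abs_neg, ← hval, ← habs,
    ofReal_integral_eq_lintegral_ofReal hintD.abs (Filter.Eventually.of_forall fun r => abs_nonneg _)]
  refine setLIntegral_congr_fun hLm fun r hr => ?_
  dsimp only
  rw [abs_mul, abs_of_nonneg (hρ r hr), ENNReal.ofReal_mul (hρ r hr), hDa]

/-- The volume element is the product of `dt`, of the volume of the hyperplanes, and of the normal
velocity. -/
theorem totalMass_eq_lintegral_leray (hP : IsPappusSolid X P ρ I c ν L) :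
    ∃ (K : ENNReal) (w : ℝ → ENNReal), K ≠ 0 ∧ K ≠ ⊤ ∧ Measurable w ∧
      (∀ t ∈ I, w t = K * ∫⁻ r in L t, ENNReal.ofReal (ρ r) *
        ENNReal.ofReal |covectorDeriv X I c ν t ⬝ᵥ r.ofLp| ∂(hyperplaneVolume X (c t) (ν t))) ∧
      K * totalMass X P ρ = ∫⁻ t in I, w t := by
  have hI := hP.measurableSet_interval
  have hPm := hP.measurableSet_solid
  have hρm : Measurable fun r => ENNReal.ofReal (ρ r) := hP.density_measurable.ennreal_ofReal
  -- Truncation of the cone to masses in `(0, 1]`, which keeps the radial constant `K = 1 / (n + 2)`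
  -- finite and nonzero.
  set φ : ℝ → ENNReal := (Ioc (0 : ℝ) 1).indicator 1 with hφ
  have hφm : Measurable φ := measurable_one.indicator measurableSet_Ioc
  -- The extra factor `s` comes from the homogeneity of the velocity; it raises the weight `s^n` on
  -- a hyperplane to the weight `s^(n+1)` of the whole space.
  set φ₁ : ℝ → ENNReal := fun s => φ s * ENNReal.ofReal s with hφ₁
  have hφ₁m : Measurable φ₁ := hφm.mul ENNReal.measurable_ofReal
  set K : ENNReal := ∫⁻ s in Ioi (0 : ℝ), ENNReal.ofReal (s ^ (n + 1)) * φ s with hK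
  have hKval : K = ENNReal.ofReal (∫ s in (0 : ℝ)..1, s ^ (n + 1)) := by
    rw [intervalIntegral.integral_of_le zero_le_one, ofReal_integral_eq_lintegral_ofReal,
      hK, ← lintegral_indicator measurableSet_Ioi, ← lintegral_indicator measurableSet_Ioc]
    · refine lintegral_congr fun s => ?_
      by_cases hs : s ∈ Ioc (0 : ℝ) 1
      · rw [indicator_of_mem hs, indicator_of_mem (show s ∈ Ioi (0 : ℝ) from hs.1), hφ,
          indicator_of_mem hs, Pi.one_apply, mul_one]
      · rw [indicator_of_notMem hs, hφ]
        simp [indicator, hs]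
    · exact (continuous_pow (n + 1)).integrableOn_Ioc
    · exact (ae_restrict_iff' measurableSet_Ioc).2 (Filter.Eventually.of_forall fun s hs =>
        pow_nonneg hs.1.le _)
  have hK1 : ∫⁻ s in Ioi (0 : ℝ), ENNReal.ofReal (s ^ n) * φ₁ s = K := by
    refine setLIntegral_congr_fun measurableSet_Ioi fun s hs => ?_
    simp only [hφ₁]
    rw [pow_succ, ENNReal.ofReal_mul (pow_nonneg (le_of_lt hs) n)]
    ring
  -- Extension by zero turns continuity on `I` into measurability on the line; only the values on
  -- `I` are used.
  set a : ℝ → Fin (n + 2) → ℝ :=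
    I.indicator fun t => normalCovector X (ν t) (form X (c t) (ν t)) with ha
  set a' : ℝ → Fin (n + 2) → ℝ := I.indicator (covectorDeriv X I c ν) with ha'
  have ham : Measurable a := measurable_indicator_of_continuousOn
    (fun t ht => (hP.hasDerivWithinAt_covector ht).continuousWithinAt) hI
  have ham' : Measurable a' := measurable_indicator_of_continuousOn hP.continuousOn_covectorDeriv hI
  have haI : ∀ t ∈ I, a t = normalCovector X (ν t) (form X (c t) (ν t)) := fun t ht =>
    indicator_of_mem ht _
  have haI' : ∀ t ∈ I, a' t = covectorDeriv X I c ν t := fun t ht => indicator_of_mem ht _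
  have had : ∀ t ∈ I, HasDerivWithinAt a (a' t) I t := by
    intro t ht
    rw [haI' t ht]
    exact (hP.hasDerivWithinAt_covector ht).congr haI (haI t ht)
  have hane : ∀ t ∈ I, a t ≠ 0 := by
    intro t ht h
    have h1 : a t ⬝ᵥ (ν t).ofLp = 1 := by
      rw [haI t ht, normalCovector_dotProduct, WithLp.toLp_ofLp, hP.normal_unit t ht]
      rcases tangent_dichotomy (hP.curve_mem t ht) with ⟨-, -, h⟩ | ⟨-, -, h⟩ <;>
      simp [h _ (hP.normal_tangent t ht)]
    rw [h, zero_dotProduct] at h1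
    exact zero_ne_one h1
  -- The cones over the sections, before truncation. Disjointness of the sections makes the
  -- projection to the space injective on this set.
  set M : Set (ℝ × (Fin (n + 2) → ℝ)) := {q | 0 < materialMass X (WithLp.toLp 2 q.2) ∧
    (q.1, (materialMass X (WithLp.toLp 2 q.2))⁻¹ • WithLp.toLp 2 q.2) ∈ parameterSet I L} with hM
  have htoLp : Measurable fun x : Fin (n + 2) → ℝ => (WithLp.toLp 2 x : Ambient (n + 1)) :=
    (MeasurableEquiv.toLp 2 (Fin (n + 2) → ℝ)).measurable
  have hMm : MeasurableSet M := by
    have h1 : Measurable fun q : ℝ × (Fin (n + 2) → ℝ) =>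
        (WithLp.toLp 2 q.2 : Ambient (n + 1)) := htoLp.comp measurable_snd
    exact (measurableSet_lt measurable_const ((continuous_materialMass X).measurable.comp h1)).inter
      ((measurable_fst.prodMk ((measurable_normalize X).comp h1)) hP.measurableSet_parameterSet)
  have hMI : ∀ q ∈ M, q.1 ∈ I := fun q hq => hq.2.1
  have hM0 : ∀ q ∈ M, a q.1 ⬝ᵥ q.2 = 0 := by
    rintro ⟨t, x⟩ ⟨hpos, ht, hr⟩
    dsimp only at hpos ht hr ⊢
    set m := materialMass X (WithLp.toLp 2 x : Ambient (n + 1))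
    obtain ⟨hs, hr0⟩ := hP.section_subset t ht hr
    have hx : x = m • (m⁻¹ • (WithLp.toLp 2 x : Ambient (n + 1))).ofLp := by
      rw [WithLp.ofLp_smul, smul_inv_smul₀ hpos.ne']
    rw [hx, dotProduct_smul, haI t ht, normalCovector_dotProduct, WithLp.toLp_ofLp]
    rw [form_sub_left] at hr0
    rcases tangent_dichotomy (hP.curve_mem t ht) with ⟨-, h, -⟩ | ⟨-, -, h⟩
    · rw [h _ hs, mul_one, hr0, smul_zero]
    · rw [h _ (hP.normal_tangent t ht)] at hr0 ⊢
      rw [zero_mul, hr0, smul_zero]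
  have hMinj : InjOn Prod.snd M := by
    rintro ⟨t, x⟩ ⟨-, hq⟩ ⟨t', x'⟩ ⟨-, hq'⟩ h
    dsimp only at h hq hq'
    subst h
    have := hP.injOn_snd_parameterSet hq hq' rfl
    rw [Prod.mk.injEq] at this ⊢
    exact ⟨this.1, rfl⟩
  set f : (Fin (n + 2) → ℝ) → ENNReal := fun x =>
    radial X φ (P.indicator fun r => ENNReal.ofReal (ρ r)) (WithLp.toLp 2 x) with hf
  have hfm : Measurable f := (measurable_radial X hφm (hρm.indicator hPm)).comp htoLp
  have hgm : Measurable (M.indicator fun q => f q.2 * ENNReal.ofReal |a' q.1 ⬝ᵥ q.2|) := by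
    refine Measurable.indicator ((hfm.comp measurable_snd).mul ?_) hMm
    refine ENNReal.measurable_ofReal.comp ?_
    unfold dotProduct
    fun_prop
  have hmain := lintegral_lamination ham ham' hI had hane hMm hMI hM0 hMinj hfm
  have hleft : ∫⁻ x in Prod.snd '' M, f x = K * totalMass X P ρ := by
    rw [← lintegral_indicator (hMm.image_of_measurable_injOn measurable_snd hMinj), totalMass,
      ← lintegral_indicator hPm, ← lintegral_radial X hφm (hρm.indicator hPm)
        (fun r hr => indicator_of_notMem (fun h => hr (hP.solid_subset_space h)) _),
      lintegral_euclidean]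
    refine lintegral_congr fun x => ?_
    by_cases hx : x ∈ Prod.snd '' M
    · rw [indicator_of_mem hx]
    · rw [indicator_of_notMem hx, radial]
      split_ifs with h
      · rw [indicator_of_notMem, mul_zero]
        intro hmem
        rw [hP.solid_eq_image] at hmem
        obtain ⟨⟨t, r⟩, hq, hr⟩ := hmem
        dsimp only at hr
        subst hr
        exact hx ⟨(t, x), ⟨h, hq⟩, rfl⟩
      · rfl
  -- Measurability in `t` is read off `leray`; `hyperplaneVolume` uses a frame chosen separately for
  -- each `t`, which hides it.
  refine ⟨K, fun t => leray (a t) fun x =>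
    M.indicator (fun q => f q.2 * ENNReal.ofReal |a' q.1 ⬝ᵥ q.2|) (t, x), ?_, ?_,
    measurable_leray ham hgm, fun t ht => ?_, hleft ▸ hmain⟩
  · rw [hKval, integral_pow]
    simp
    positivity
  · rw [hKval]
    exact ENNReal.ofReal_ne_top
  · have hLm := hP.measurableSet_section ht
    set G : Ambient (n + 1) → ENNReal := (L t).indicator fun r =>
      ENNReal.ofReal (ρ r) * ENNReal.ofReal |covectorDeriv X I c ν t ⬝ᵥ r.ofLp| with hG
    have hGm : Measurable G := by
      refine Measurable.indicator (hρm.mul (ENNReal.measurable_ofReal.comp ?_)) hLm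
      unfold dotProduct
      fun_prop
    have hGx : ∀ x, M.indicator (fun q => f q.2 * ENNReal.ofReal |a' q.1 ⬝ᵥ q.2|) (t, x) =
        radial X φ₁ G (WithLp.toLp 2 x) := by
      intro x
      rw [radial]
      split_ifs with hpos
      · by_cases hr : (materialMass X (WithLp.toLp 2 x : Ambient (n + 1)))⁻¹ •
            (WithLp.toLp 2 x : Ambient (n + 1)) ∈ L t
        · rw [indicator_of_mem (show (t, x) ∈ M from ⟨hpos, ht, hr⟩), hG, indicator_of_mem hr]
          simp only [hf, radial, if_pos hpos, indicator_of_mem (hP.section_subset_solid ht hr),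
            hφ₁, haI' t ht, WithLp.ofLp_smul, dotProduct_smul, smul_eq_mul, abs_mul,
            abs_of_pos (inv_pos.2 hpos)]
          rw [ENNReal.ofReal_mul (inv_pos.2 hpos).le, ENNReal.ofReal_inv_of_pos hpos]
          have h1 : ENNReal.ofReal (materialMass X (WithLp.toLp 2 x : Ambient (n + 1))) ≠ 0 :=
            (ENNReal.ofReal_pos.2 hpos).ne'
          rw [mul_left_comm (ENNReal.ofReal (ρ _)), mul_assoc (φ _), mul_assoc (φ _),
            ← mul_assoc (ENNReal.ofReal (materialMass X (WithLp.toLp 2 x))),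
            ENNReal.mul_inv_cancel h1 ENNReal.ofReal_ne_top, one_mul]
        · rw [indicator_of_notMem fun h => hr h.2.2, hG, indicator_of_notMem hr, mul_zero]
      · exact indicator_of_notMem (fun h => hpos h.1) _
    dsimp only
    simp only [hGx]
    rw [haI t ht, leray_radial (hP.curve_mem t ht) (hP.normal_tangent t ht) (hP.normal_unit t ht)
      hφ₁m hGm (fun r hr => indicator_of_notMem (fun h => hr (hP.section_subset_space ht h)) _),
      hK1, hG, lintegral_indicator hLm]

end IsPappusSolid

end Pappus

/-! ### Cancellation of the radial constant. -/

theorem mainTheorem5 (X : Pappus.Geometry) (n : ℕ)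
    (P : Set (Pappus.Ambient (n + 1))) (ρ : Pappus.Ambient (n + 1) → ℝ)
    (I : Set ℝ) (c ν : ℝ → Pappus.Ambient (n + 1)) (L : ℝ → Set (Pappus.Ambient (n + 1)))
    (hP : Pappus.IsPappusSolid X P ρ I c ν L) :
    AEMeasurable (fun t => Pappus.centeredMass X (c t) (ν t) (L t) ρ *
        Real.cos (Pappus.slantAngle X (derivWithin c I t) (ν t))) (volume.restrict I) ∧
      Pappus.totalMass X P ρ =
        ∫⁻ t in I, ENNReal.ofReal (Pappus.centeredMass X (c t) (ν t) (L t) ρ *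
          Real.cos (Pappus.slantAngle X (derivWithin c I t) (ν t))) := by
  have hI := hP.measurableSet_interval
  obtain ⟨K, w, hK0, hKt, hw, hwI, hmass⟩ := hP.totalMass_eq_lintegral_leray
  have hval : ∀ t ∈ I, w t = K * ENNReal.ofReal (Pappus.centeredMass X (c t) (ν t) (L t) ρ *
      Real.cos (Pappus.slantAngle X (derivWithin c I t) (ν t))) := fun t ht => by
    rw [hwI t ht, hP.lintegral_section ht]
  have hdiv : ∀ t ∈ I, K⁻¹ * w t = ENNReal.ofReal (Pappus.centeredMass X (c t) (ν t) (L t) ρ *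
      Real.cos (Pappus.slantAngle X (derivWithin c I t) (ν t))) := fun t ht => by
    rw [hval t ht, ← mul_assoc, ENNReal.inv_mul_cancel hK0 hKt, one_mul]
  constructor
  -- The integrand is nonnegative, so `toReal` recovers it on `I` from its image in `ENNReal`.
  · refine ⟨fun t => (K⁻¹ * w t).toReal, (hw.const_mul _).ennreal_toReal,
      (ae_restrict_iff' hI).2 (Filter.Eventually.of_forall fun t ht => ?_)⟩
    dsimp only
    rw [hdiv t ht, ENNReal.toReal_ofReal]
    rw [hP.cos_slantAngle ht]
    exact mul_nonneg (hP.centeredMass_nonneg ht) (abs_nonneg _)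
  · rw [← setLIntegral_congr_fun hI hdiv, lintegral_const_mul _ hw, ← hmass, ← mul_assoc,
      ENNReal.inv_mul_cancel hK0 hKt, one_mul]
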